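/- Let $(X,Y)$ be a random pair with $X\in\mathbb{R}^p$, $Y\in\mathbb{R}$, $E|Y|<\infty$, and let $(X_1,Y_1),(X_2,Y_2),\dots$ be i.i.d. copies of it. For a real random variable $W$ that is a function of $(X,Y)$, a subspace $S\subseteq\mathbb{R}^p$ is a dimension reduction subspace for $W|X$ if $W$ and $X$ are independent given $P_SX$ ($P_S$ the orthogonal projection onto $S$); the central subspace $\mathcal{S}_{W|X}$ is the intersection of all of them. The central mean subspace $\mathcal{S}_{E(Y|X)}$ is the intersection of all $S$ such that $Y$ and $E(Y|X)$ are independent given $P_SX$. Put $Z(t)=I\{Y\le t\}$. Assume that $\mathcal{S}_{Z(t)|X}$ is itself a dimension reduction subspace for $Z(t)|X$ for every $t\in\mathbb R$, and that $\mathcal{S}_{E(Y|X)}=\mathcal{S}_{Y|X}$. Consider any sufficient dimension reduction method with target matrices $M(t)$ and estimates $M_n(t)$ (symmetric $p\times p$ matrices, $M_n(t)$ a function of $t$ and of the first $n$ observations) satisfying the following regularity conditions: $M(t)$ is positive semi-definite with column space $\mathcal{S}_{Z(t)|X}$ for every $t$; $E\|M(Y)\|<\infty$; and $$M_n(t)=M(t)+\frac1n\sum_{i=1}^n\psi(X_i,Y_i,t)+R_n(t),\qquad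 \sup_t\|R_n(t)\|_F=o_p(n^{-1/2}),$$ where, for every $t$, $E\psi(X,Y,t)=0$ and $E\|\psi(X,Y,t)\|^2<\infty$, and moreover $E\|\psi(X,Y,\tilde Y)\|^2<\infty$ for an independent copy $\tilde Y$ of $Y$, and $E\|\psi(X,Y,Y)\|<\infty$. The discretization-expectation (DEE) matrix is $M_n=\frac1n\sum_{i=1}^nM_n(Y_i)$; let $\hat\lambda_1\ge\dots\ge\hat\lambda_p$ be its eigenvalues and put $\hat\lambda_{p+1}=0$. Let $\hat q$ be a minimum ridge-type eigenvalue ratio estimator, that is, any choice of $$\hat q\in\arg\min_{1\le i\le p}\frac{\hat\lambda_{i+1}^2+c}{\hat\lambda_i^2+c},\qquad c=\frac{\log n}{n}.$$ Let $g(\cdot,\theta)$, $\theta\in\Theta\subseteq\mathbb{R}^d$, be given measurable functions on $\mathbb R$. Then, as $n\to\infty$: (i) Under $H_0$: $E(Y|X)=g(\beta_0^\top X,\theta_0)$ a.s. for some $\beta_0\in\mathbb{R}^p$, $\theta_0\in\Theta$, where $E(Y|X)$ is not a.s. constant, one has $\Pr(\hat q=1)\to1$. (ii) Under $H_1$: $E(Y|X)=G(B^\top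 X)$ a.s. for some measurable $G$ and some $p\times q$ matrix $B$ with orthogonal columns, where $q\ge1$ is the least number of columns for which $E(Y|X)$ has a representation $G'(B'^\top X)$ with measurable $G'$, and for no $\beta\in\mathbb{R}^p$, $\theta\in\Theta$ is $E(Y|X)=g(\beta^\top X,\theta)$ a.s., one has $\Pr(\hat q=q)\to1$. -/

import Mathlib

open MeasureTheory ProbabilityTheory Filter Topology

noncomputable section

/-- The space `ℝᵖ` of covariates, with the Euclidean inner product. -/
abbrev Covar (p : ℕ) := EuclideanSpace ℝ (Fin p)

/-- The space of one observation `(X, Y)`: a covariate vector and a real response. -/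
abbrev Obs (p : ℕ) := Covar p × ℝ

/-- The σ-algebra on the observation space generated by `P_S X`, the orthogonal projection of the
covariates on `S`. It is the σ-algebra generated by `Aᵀ X`, for every matrix `A` whose columns
span `S`. -/
@[reducible] def projSigma {p : ℕ} (S : Submodule ℝ (Covar p)) : MeasurableSpace (Obs p) :=
  MeasurableSpace.comap (fun z : Obs p => S.starProjection z.1) inferInstance

theorem projSigma_le {p : ℕ} (S : Submodule ℝ (Covar p)) :
    projSigma S ≤ (inferInstance : MeasurableSpace (Obs p)) :=
  (S.starProjection.continuous.measurable.comp measurable_fst).comap_le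

/-- `S` is a dimension reduction subspace for the regression of the response `W` (a function of
the observation) on `X`: `W` and `X` are independent given `P_S X`. -/
def IsDimReduction {p : ℕ} (P : Measure (Obs p)) [IsProbabilityMeasure P] (W : Obs p → ℝ)
    (S : Submodule ℝ (Covar p)) : Prop :=
  CondIndepFun (projSigma S) (projSigma_le S) W (Prod.fst : Obs p → Covar p) P

/-- The central subspace `𝓢_{W|X}`: the intersection of all dimension reduction subspaces. -/
def centralSubspace {p : ℕ} (P : Measure (Obs p)) [IsProbabilityMeasure P] (W : Obs p → ℝ) :
    Submodule ℝ (Covar p) :=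
  sInf {S | IsDimReduction P W S}

/-- The regression function `E(Y | X)`, as a random variable on the observation space. -/
def condMean {p : ℕ} (P : Measure (Obs p)) : Obs p → ℝ :=
  P[(Prod.snd : Obs p → ℝ) |
    MeasurableSpace.comap (Prod.fst : Obs p → Covar p) inferInstance]

/-- `S` is a mean dimension reduction subspace: `Y` and `E(Y | X)` are independent given
`P_S X`. -/
def IsMeanDimReduction {p : ℕ} (P : Measure (Obs p)) [IsProbabilityMeasure P]
    (S : Submodule ℝ (Covar p)) : Prop :=
  CondIndepFun (projSigma S) (projSigma_le S) (Prod.snd : Obs p → ℝ) (condMean P) P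

/-- The central mean subspace `𝓢_{E(Y|X)}`: the intersection of all mean dimension reduction
subspaces. -/
def centralMeanSubspace {p : ℕ} (P : Measure (Obs p)) [IsProbabilityMeasure P] :
    Submodule ℝ (Covar p) :=
  sInf {S | IsMeanDimReduction P S}

/-- The discretized response `Z(t) = I{Y ≤ t}`. -/
def discretized {p : ℕ} (t : ℝ) : Obs p → ℝ :=
  {z : Obs p | z.2 ≤ t}.indicator 1

/-- The column space of a `p × p` matrix, as a subspace of `ℝᵖ`. -/
def matrixSpan {p : ℕ} (A : Matrix (Fin p) (Fin p) ℝ) : Submodule ℝ (Covar p) :=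
  Submodule.span ℝ (Set.range fun j => (WithLp.toLp 2 (A.col j) : Covar p))

/-- The vector `Bᵀ x`. -/
def transposeApply {p q : ℕ} (B : Matrix (Fin p) (Fin q) ℝ) (x : Covar p) : Covar q :=
  WithLp.toLp 2 (B.transpose.mulVec x.ofLp)

/-- The Frobenius norm of a matrix. -/
def frobNorm {p : ℕ} (A : Matrix (Fin p) (Fin p) ℝ) : ℝ :=
  √(∑ i, ∑ j, A i j ^ 2)

/-- An estimator of a matrix-valued function `t ↦ M(t)`: for each sample of size `n`, an estimate
of each `M(t)`. -/
abbrev KernelEstimator (p : ℕ) :=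
  (n : ℕ) → (Fin n → Obs p) → ℝ → Matrix (Fin p) (Fin p) ℝ

/-- The discretization-expectation estimate `M_n = n⁻¹ ∑ᵢ M_n(yᵢ)`. -/
def deeMatrix {p : ℕ} (Mn : KernelEstimator p) (n : ℕ) (s : Fin n → Obs p) :
    Matrix (Fin p) (Fin p) ℝ :=
  (n : ℝ)⁻¹ • ∑ i, Mn n s (s i).2

/-- The remainder `R_n(t) = M_n(t) - M(t) - n⁻¹ ∑ᵢ ψ(xᵢ, yᵢ, t)`. -/
def linRemainder {p : ℕ} (M : ℝ → Matrix (Fin p) (Fin p) ℝ)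
    (ψ : Obs p → ℝ → Matrix (Fin p) (Fin p) ℝ) (Mn : KernelEstimator p)
    (n : ℕ) (s : Fin n → Obs p) (t : ℝ) : Matrix (Fin p) (Fin p) ℝ :=
  Mn n s t - M t - (n : ℝ)⁻¹ • ∑ i, ψ (s i) t

/-- The first `n` observations of a sequence of observations. -/
def sampleOf {p : ℕ} {Ω : Type*} (Z : ℕ → Ω → Obs p) (n : ℕ) (ω : Ω) : Fin n → Obs p :=
  fun i => Z i ω

/-- `Z 0, Z 1, …` are independent observations with common distribution `P`. -/
structure IsIIDSample {p : ℕ} {Ω : Type*} [MeasurableSpace Ω] (μ : Measure Ω)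
    (P : Measure (Obs p)) (Z : ℕ → Ω → Obs p) : Prop where
  measurable : ∀ i, Measurable (Z i)
  law : ∀ i, μ.map (Z i) = P
  indep : iIndepFun Z μ

/-- `M(t)` is a candidate matrix of a sufficient dimension reduction method for the discretized
responses: it is positive semi-definite, its columns span the central subspace of `Z(t) | X`, and
`E M(Ỹ)` exists. -/
structure IsDEEKernel {p : ℕ} (P : Measure (Obs p)) [IsProbabilityMeasure P]
    (M : ℝ → Matrix (Fin p) (Fin p) ℝ) : Prop where
  posSemidef : ∀ t, (M t).PosSemidef
  span_eq : ∀ t, matrixSpan (M t) = centralSubspace P (discretized t)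
  integrable : ∀ i j, Integrable (fun z : Obs p => M z.2 i j) P

/-- The symmetric estimate `M_n(t)` of `M(t)` admits the asymptotically linear expansion
`M_n(t) = M(t) + n⁻¹ ∑ᵢ ψ(xᵢ, yᵢ, t) + R_n(t)`, in which `ψ` is centred and has finite moments
(`Ỹ` is an independent copy of `Y`), and `sup_t ‖R_n(t)‖_F = o_p(n^{-1/2})`. -/
structure HasLinearExpansion {p : ℕ} {Ω : Type*} [MeasurableSpace Ω] (μ : Measure Ω)
    (P : Measure (Obs p)) (Z : ℕ → Ω → Obs p) (M : ℝ → Matrix (Fin p) (Fin p) ℝ)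
    (ψ : Obs p → ℝ → Matrix (Fin p) (Fin p) ℝ) (Mn : KernelEstimator p) : Prop where
  symm : ∀ n s t, (Mn n s t).IsSymm
  /-- `E ψ(X, Y, t) = 0` and `E ‖ψ(X, Y, t)‖² < ∞` for every `t`. -/
  centred : ∀ t i j, MemLp (fun z => ψ z t i j) 2 P ∧ ∫ z, ψ z t i j ∂P = 0
  /-- `E ‖ψ(X, Y, Ỹ)‖² < ∞`. -/
  sq_integrable : ∀ i j,
    MemLp (fun w : Obs p × ℝ => ψ w.1 w.2 i j) 2 (P.prod (P.map (Prod.snd : Obs p → ℝ)))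
  /-- `E ‖ψ(X, Y, Y)‖ < ∞`. -/
  diag_integrable : ∀ i j, Integrable (fun z : Obs p => ψ z z.2 i j) P
  /-- `√n sup_t ‖R_n(t)‖_F → 0` in probability. -/
  remainder : ∀ ε : ℝ, 0 < ε → Tendsto
    (fun n : ℕ => μ {ω | ∃ t, ε < √(n : ℝ) * frobNorm (linRemainder M ψ Mn n (sampleOf Z n ω) t)})
    atTop (𝓝 0)

/-- `eigDesc A i` is the `i`-th largest eigenvalue (`1 ≤ i ≤ p`, with multiplicity) of a real
symmetric `p × p` matrix `A`; in particular `eigDesc A (p + 1) = 0` by convention. -/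
def eigDesc {p : ℕ} (A : Matrix (Fin p) (Fin p) ℝ) (i : ℕ) : ℝ :=
  open Classical in
  if h : A.IsHermitian ∧ 1 ≤ i ∧ i ≤ p then
    h.1.eigenvalues₀ ⟨i - 1, by rw [Fintype.card_fin]; have := h.2; omega⟩
  else 0

/-- The ridge-type eigenvalue ratio `(λ̂²_{i+1} + c) / (λ̂²_i + c)`. -/
def ridgeRatio {p : ℕ} (A : Matrix (Fin p) (Fin p) ℝ) (c : ℝ) (i : ℕ) : ℝ :=
  (eigDesc A (i + 1) ^ 2 + c) / (eigDesc A i ^ 2 + c)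

/-- `i` is a minimizer over `{1, …, p}` of the ridge-type eigenvalue ratio. -/
def IsMRER {p : ℕ} (A : Matrix (Fin p) (Fin p) ℝ) (c : ℝ) (i : ℕ) : Prop :=
  i ∈ Finset.Icc 1 p ∧ ∀ j ∈ Finset.Icc 1 p, ridgeRatio A c i ≤ ridgeRatio A c j

/-- The null hypothesis: `E(Y|X) = g(β₀ᵀX, θ₀)` for some `β₀ ∈ ℝᵖ` and `θ₀ ∈ Θ`, and the regression
is not degenerate, that is, `E(Y|X)` is not almost surely constant. -/
def NullHyp {p d : ℕ} (P : Measure (Obs p)) (g : ℝ → EuclideanSpace ℝ (Fin d) → ℝ)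
    (Θ : Set (EuclideanSpace ℝ (Fin d))) : Prop :=
  (∃ β₀ : Covar p, ∃ θ₀ ∈ Θ, condMean P =ᵐ[P] fun z => g (inner ℝ β₀ z.1) θ₀) ∧
  ∀ a : ℝ, ¬ condMean P =ᵐ[P] fun _ => a

/-- `E(Y|X) = G(BᵀX)` for some measurable `G`. -/
def IsMultiIndex {p q : ℕ} (P : Measure (Obs p)) (B : Matrix (Fin p) (Fin q) ℝ) : Prop :=
  ∃ G : Covar q → ℝ, Measurable G ∧ condMean P =ᵐ[P] fun z => G (transposeApply B z.1)

/-- The alternative hypothesis with structural dimension `q`: `E(Y|X) = G(BᵀX)` for a `p × q` matrix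
`B` with orthogonal columns, `q ≥ 1` being the least number of columns for which such a
representation exists, and `E(Y|X)` is not of the form `g(βᵀX, θ)`. -/
def AltHyp {p d : ℕ} (P : Measure (Obs p)) (g : ℝ → EuclideanSpace ℝ (Fin d) → ℝ)
    (Θ : Set (EuclideanSpace ℝ (Fin d))) (q : ℕ) : Prop :=
  1 ≤ q ∧
  (∃ B : Matrix (Fin p) (Fin q) ℝ, (B.transpose * B).IsDiag ∧ IsMultiIndex P B) ∧
  (∀ (r : ℕ) (B : Matrix (Fin p) (Fin r) ℝ), IsMultiIndex P B → q ≤ r) ∧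
  ∀ (β : Covar p), ∀ θ ∈ Θ, ¬ condMean P =ᵐ[P] fun z => g (inner ℝ β z.1) θ

end

/-! ### Min-max bounds for eigenvalues, and the ridge ratios. -/

noncomputable section

/-! Let `C` be the central subspace of `Y | X`. The theorem splits into `q̂ → dim C` in probability
and the identification of `dim C` with the number of indices of `E(Y|X)`.

Identification: `C` is a dimension reduction subspace for `Y | X` (`isDimReduction_snd_of_ae_le`),
hence a mean dimension reduction subspace, and by hypothesis it is the central mean subspace. A
subspace `S` is mean dimension reducing iff `E(Y|X)` is a.s. a function of `P_S X`, so `dim C` is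
the least number of indices: `q` under `H₁`, and `1` under `H₀`, where dimension `0` would make
`E(Y|X)` constant.

Consistency: compare `M_n` with the sample average `A₀` of the `M(Y_i)` rather than with `E M(Y)`.
Each `M(t)` vanishes on `Cᗮ`, so `A₀` does so exactly, and the eigenvalues of `M_n` beyond `dim C`
are bounded by `M_n - A₀` alone. This difference is a double sum of `ψ` plus a remainder; a variance
bound makes it `O_p(n^{-1/2})`, below `√c`. The leading eigenvalues only need a law of large numbers
for `A₀`, since `E M(Y)` is positive definite on `C`: if `xᵀ E M(Y) x = 0`, then almost surely `x`
is orthogonal to the columns of `M(Y)`, so the orthogonal complement of `x` is a dimension reduction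
subspace for `Y | X` and contains `C`.

The ridge ratio is then of order `c` at `dim C`, bounded below before it, and at least `1/2` after
it. -/

theorem OrthonormalBasis.exists_mem_repr_eq_zero {ι E : Type*} [Fintype ι] [NormedAddCommGroup E]
    [InnerProductSpace ℝ E] (b : OrthonormalBasis ι ℝ E) (F : Finset ι) (S : Submodule ℝ E)
    (hF : F.card < Module.finrank ℝ S) :
    ∃ x ∈ S, x ≠ 0 ∧ ∀ j ∈ F, b.repr x j = 0 := by
  classical
  have : FiniteDimensional ℝ E := b.toBasis.finiteDimensional_of_finite
  let L : S →ₗ[ℝ] (F → ℝ) :=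
    LinearMap.pi fun j => (EuclideanSpace.proj (𝕜 := ℝ) (j : ι)).toLinearMap ∘ₗ
      b.repr.toLinearEquiv.toLinearMap ∘ₗ S.subtype
  have hker : LinearMap.ker L ≠ ⊥ := LinearMap.ker_ne_bot_of_finrank_lt (by simpa using hF)
  obtain ⟨x, hx, hx0⟩ := (Submodule.ne_bot_iff _).1 hker
  refine ⟨x, x.2, by simpa using hx0, fun j hj => ?_⟩
  have := congrFun (LinearMap.mem_ker.1 hx) ⟨j, hj⟩
  simpa [L] using this

/-- One half of Courant–Fischer: by dimension count `S` has a nonzero vector without coordinates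
before `k`, and there the form is at most `l k * ‖x‖ ^ 2`. -/
theorem le_of_antitone_of_forall_mem_le {m : ℕ} {E : Type*} [NormedAddCommGroup E]
    [InnerProductSpace ℝ E] (b : OrthonormalBasis (Fin m) ℝ E) {l : Fin m → ℝ} (hl : Antitone l)
    {S : Submodule ℝ E} {k : Fin m} (hk : (k : ℕ) < Module.finrank ℝ S) {δ : ℝ}
    (h : ∀ x ∈ S, δ * ‖x‖ ^ 2 ≤ ∑ i, l i * b.repr x i ^ 2) : δ ≤ l k := by
  obtain ⟨x, hxS, hx0, hx⟩ := b.exists_mem_repr_eq_zero (Finset.Iio k) S (by simpa using hk)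
  have hn : ‖x‖ ^ 2 = ∑ i, b.repr x i ^ 2 := by
    rw [← b.repr.norm_map, EuclideanSpace.real_norm_sq_eq]
  have h1 : ∑ i, l i * b.repr x i ^ 2 ≤ l k * ‖x‖ ^ 2 := by
    rw [hn, Finset.mul_sum]
    refine Finset.sum_le_sum fun i _ => ?_
    by_cases hi : i < k
    · simp [hx i (by simpa using hi)]
    · exact mul_le_mul_of_nonneg_right (hl (not_lt.1 hi)) (sq_nonneg _)
  exact le_of_mul_le_mul_right ((h x hxS).trans h1) (by positivity)

theorem le_of_antitone_of_forall_mem_ge {m : ℕ} {E : Type*} [NormedAddCommGroup E]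
    [InnerProductSpace ℝ E] (b : OrthonormalBasis (Fin m) ℝ E) {l : Fin m → ℝ} (hl : Antitone l)
    {S : Submodule ℝ E} {k : Fin m} (hk : m ≤ k + Module.finrank ℝ S) {δ : ℝ}
    (h : ∀ x ∈ S, ∑ i, l i * b.repr x i ^ 2 ≤ δ * ‖x‖ ^ 2) : l k ≤ δ := by
  obtain ⟨x, hxS, hx0, hx⟩ := b.exists_mem_repr_eq_zero (Finset.Ioi k) S (by
    rw [Fin.card_Ioi]; have := k.2; omega)
  have hn : ‖x‖ ^ 2 = ∑ i, b.repr x i ^ 2 := by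
    rw [← b.repr.norm_map, EuclideanSpace.real_norm_sq_eq]
  have h1 : l k * ‖x‖ ^ 2 ≤ ∑ i, l i * b.repr x i ^ 2 := by
    rw [hn, Finset.mul_sum]
    refine Finset.sum_le_sum fun i _ => ?_
    by_cases hi : k < i
    · simp [hx i (by simpa using hi)]
    · exact mul_le_mul_of_nonneg_right (hl (not_lt.1 hi)) (sq_nonneg _)
  exact le_of_mul_le_mul_right (h1.trans (h x hxS)) (by positivity)

/-! ### Eigenvalues of a symmetric matrix through its quadratic form. -/

/-- The quadratic form `xᵀ A x`. -/
def quadForm {p : ℕ} (A : Matrix (Fin p) (Fin p) ℝ) (x : Covar p) : ℝ :=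
  ∑ i, ∑ j, x i * A i j * x j

theorem quadForm_eq_dotProduct {p : ℕ} (A : Matrix (Fin p) (Fin p) ℝ) (x : Covar p) :
    quadForm A x = x.ofLp ⬝ᵥ A.mulVec x.ofLp := by
  simp [quadForm, dotProduct, Matrix.mulVec, Finset.mul_sum, mul_assoc]

theorem quadForm_sub {p : ℕ} (A B : Matrix (Fin p) (Fin p) ℝ) (x : Covar p) :
    quadForm (A - B) x = quadForm A x - quadForm B x := by
  simp [quadForm, mul_sub, sub_mul, Finset.sum_sub_distrib]

theorem quadForm_smul {p : ℕ} (a : ℝ) (A : Matrix (Fin p) (Fin p) ℝ) (x : Covar p) :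
    quadForm (a • A) x = a * quadForm A x := by
  simp only [quadForm, Finset.mul_sum, Matrix.smul_apply, smul_eq_mul]
  refine Finset.sum_congr rfl fun i _ => Finset.sum_congr rfl fun j _ => by ring

theorem quadForm_sum {p : ℕ} {ι : Type*} (s : Finset ι) (A : ι → Matrix (Fin p) (Fin p) ℝ)
    (x : Covar p) : quadForm (∑ k ∈ s, A k) x = ∑ k ∈ s, quadForm (A k) x := by
  simp only [quadForm, Matrix.sum_apply, Finset.mul_sum, Finset.sum_mul]
  rw [Finset.sum_congr rfl fun i _ => Finset.sum_comm, Finset.sum_comm]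

/-- The sum of the absolute values of the entries of a matrix. -/
def entrySum {p : ℕ} (A : Matrix (Fin p) (Fin p) ℝ) : ℝ := ∑ i, ∑ j, |A i j|

theorem entrySum_nonneg {p : ℕ} (A : Matrix (Fin p) (Fin p) ℝ) : 0 ≤ entrySum A :=
  Finset.sum_nonneg fun _ _ => Finset.sum_nonneg fun _ _ => abs_nonneg _

theorem abs_quadForm_le {p : ℕ} (A : Matrix (Fin p) (Fin p) ℝ) (x : Covar p) :
    |quadForm A x| ≤ entrySum A * ‖x‖ ^ 2 := by
  have hx : ∀ i, |x i| ≤ ‖x‖ := fun i => by simpa using PiLp.norm_apply_le x i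
  rw [quadForm, entrySum, Finset.sum_mul]
  refine (Finset.abs_sum_le_sum_abs _ _).trans (Finset.sum_le_sum fun i _ => ?_)
  rw [Finset.sum_mul]
  refine (Finset.abs_sum_le_sum_abs _ _).trans (Finset.sum_le_sum fun j _ => ?_)
  rw [abs_mul, abs_mul]
  calc |x i| * |A i j| * |x j| = |A i j| * (|x i| * |x j|) := by ring
    _ ≤ |A i j| * (‖x‖ * ‖x‖) := by gcongr <;> exact hx _
    _ = _ := by ring

/-- The spectral theorem, indexed as `eigenvalues₀` is, so that the coefficients come in decreasing
order. -/
theorem exists_orthonormalBasis_quadForm {p : ℕ} {A : Matrix (Fin p) (Fin p) ℝ}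
    (hA : A.IsHermitian) :
    ∃ b : OrthonormalBasis (Fin (Fintype.card (Fin p))) ℝ (Covar p), ∀ x,
      quadForm A x = ∑ i, hA.eigenvalues₀ i * b.repr x i ^ 2 := by
  have hT := Matrix.isSymmetric_toEuclideanLin_iff.mpr hA
  refine ⟨hT.eigenvectorBasis finrank_euclideanSpace, fun x => ?_⟩
  have h1 : quadForm A x = inner ℝ x (Matrix.toEuclideanLin A x) := by
    rw [quadForm_eq_dotProduct, EuclideanSpace.inner_eq_star_dotProduct]
    simp [dotProduct_comm]
  rw [h1, ← (hT.eigenvectorBasis finrank_euclideanSpace).repr.inner_map_map, PiLp.inner_apply]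
  refine Finset.sum_congr rfl fun i _ => ?_
  rw [hT.eigenvectorBasis_apply_self_apply]
  simp only [RCLike.inner_apply, conj_trivial, Matrix.IsHermitian.eigenvalues₀]
  simp only [RCLike.ofReal_real_eq_id, id_eq]
  ring

theorem le_eigDesc {p : ℕ} {A : Matrix (Fin p) (Fin p) ℝ} (hA : A.IsHermitian) {i : ℕ}
    (h1 : 1 ≤ i) {S : Submodule ℝ (Covar p)} (hi : i ≤ Module.finrank ℝ S) {δ : ℝ}
    (h : ∀ x ∈ S, δ * ‖x‖ ^ 2 ≤ quadForm A x) : δ ≤ eigDesc A i := by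
  have hp : i ≤ p := hi.trans (by simpa using S.finrank_le)
  obtain ⟨b, hb⟩ := exists_orthonormalBasis_quadForm hA
  rw [eigDesc, dif_pos ⟨hA, h1, hp⟩]
  refine le_of_antitone_of_forall_mem_le b hA.eigenvalues₀_antitone (S := S) ?_ ?_
  · simp only; omega
  · exact fun x hx => (h x hx).trans_eq (hb x)

theorem eigDesc_le {p : ℕ} {A : Matrix (Fin p) (Fin p) ℝ} (hA : A.IsHermitian) {i : ℕ}
    (h1 : 1 ≤ i) (hp : i ≤ p) {S : Submodule ℝ (Covar p)} (hi : p < i + Module.finrank ℝ S) {δ : ℝ}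
    (h : ∀ x ∈ S, quadForm A x ≤ δ * ‖x‖ ^ 2) : eigDesc A i ≤ δ := by
  obtain ⟨b, hb⟩ := exists_orthonormalBasis_quadForm hA
  rw [eigDesc, dif_pos ⟨hA, h1, hp⟩]
  refine le_of_antitone_of_forall_mem_ge b hA.eigenvalues₀_antitone (S := S) ?_ ?_
  · simp only [Fintype.card_fin]; omega
  · exact fun x hx => (hb x).symm.trans_le (h x hx)

theorem abs_eigDesc_le {p : ℕ} {A : Matrix (Fin p) (Fin p) ℝ} (hA : A.IsHermitian) (i : ℕ)
    {K : ℝ} (hK : 0 ≤ K) (h : ∀ x, |quadForm A x| ≤ K * ‖x‖ ^ 2) : |eigDesc A i| ≤ K := by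
  by_cases hi : 1 ≤ i ∧ i ≤ p
  · refine abs_le.2 ⟨le_eigDesc hA hi.1 (S := ⊤) (by simpa using hi.2) fun x _ => ?_,
      eigDesc_le hA hi.1 hi.2 (S := ⊤) (by simp; omega) fun x _ => (abs_le.1 (h x)).2⟩
    linarith [(abs_le.1 (h x)).1]
  · rw [eigDesc, dif_neg (fun h => hi h.2)]
    simpa using hK

/-- The ratio at `q` is at most `2 * c / δ ^ 2`. Before `q` it is at least `δ ^ 2 / (K ^ 2 + c)`,
and `hc2` separates the two; after `q` the ridge dominates both squares and the ratio is at least `1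
/ 2`, which `hc1` separates. -/
theorem IsMRER.eq_of_bounds {p : ℕ} {A : Matrix (Fin p) (Fin p) ℝ} {c K δ : ℝ} {q i : ℕ}
    (hq1 : 1 ≤ q) (hqp : q ≤ p) (hc : 0 < c) (hδ : 0 < δ)
    (hK : ∀ j, |eigDesc A j| ≤ K) (hlarge : ∀ j, 1 ≤ j → j ≤ q → δ ≤ eigDesc A j)
    (hsmall : ∀ j, q < j → eigDesc A j ^ 2 ≤ c)
    (hc1 : 4 * c < δ ^ 2) (hc2 : 2 * c * (K ^ 2 + c) < δ ^ 2 * δ ^ 2)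
    (h : IsMRER A c i) : i = q := by
  obtain ⟨hi, hmin⟩ := h
  rw [Finset.mem_Icc] at hi
  have hsq : ∀ j, 1 ≤ j → j ≤ q → δ ^ 2 ≤ eigDesc A j ^ 2 := fun j h1 h2 =>
    pow_le_pow_left₀ hδ.le (hlarge j h1 h2) 2
  have hKsq : ∀ j, eigDesc A j ^ 2 ≤ K ^ 2 := fun j => by
    rw [← sq_abs]; exact pow_le_pow_left₀ (abs_nonneg _) (hK j) 2
  have hpos : 0 < δ ^ 2 := by positivity
  have hden : 0 < K ^ 2 + c := by positivity
  have hq : ridgeRatio A c q ≤ 2 * c / δ ^ 2 := by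
    rw [ridgeRatio]
    have := hsmall (q + 1) (by omega)
    have := hsq q hq1 le_rfl
    gcongr <;> linarith
  have hmin' := (hmin q (Finset.mem_Icc.2 ⟨hq1, hqp⟩)).trans hq
  rcases lt_trichotomy i q with hlt | heq | hgt
  · exfalso
    have h1 : δ ^ 2 / (K ^ 2 + c) ≤ ridgeRatio A c i := by
      rw [ridgeRatio]
      have := hsq (i + 1) (by omega) (by omega)
      have := hKsq i
      have := sq_nonneg (eigDesc A i)
      gcongr
      linarith
    have h2 := h1.trans hmin'
    rw [div_le_div_iff₀ hden hpos] at h2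
    linarith
  · exact heq
  · exfalso
    have h1 : c / (2 * c) ≤ ridgeRatio A c i := by
      rw [ridgeRatio]
      have := hsmall i hgt
      have := sq_nonneg (eigDesc A i)
      have := sq_nonneg (eigDesc A (i + 1))
      gcongr <;> linarith
    have h2 := h1.trans hmin'
    rw [div_le_div_iff₀ (by positivity) hpos] at h2
    nlinarith

/-- A perturbation bound: if `A` is within `√c` of a positive semi-definite matrix `A₀` that
vanishes on `Cᗮ`, and `A₀` is close to a matrix that is positive definite on `C`, then the
minimizer of the ridge ratios of `A` is the dimension of `C`. -/
theorem IsMRER.eq_finrank {p : ℕ} {A A₀ A₁ : Matrix (Fin p) (Fin p) ℝ} {c δ : ℝ} {i : ℕ}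
    {C : Submodule ℝ (Covar p)} (hA : A.IsSymm) (hC : 1 ≤ Module.finrank ℝ C)
    (hδ : 0 < δ) (hc : 0 < c) (hc0 : √c ≤ δ) (hc1 : 4 * c < δ ^ 2)
    (hc2 : 2 * c * ((entrySum A₁ + 2 * δ) ^ 2 + c) < δ ^ 2 * δ ^ 2)
    (hA₀ : ∀ x, 0 ≤ quadForm A₀ x) (hA₀C : ∀ x ∈ Cᗮ, quadForm A₀ x = 0)
    (hA₁ : ∀ x ∈ C, 3 * δ * ‖x‖ ^ 2 ≤ quadForm A₁ x)
    (h₁ : entrySum (A - A₀) ≤ √c) (h₂ : entrySum (A₀ - A₁) ≤ δ)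
    (h : IsMRER A c i) : i = Module.finrank ℝ C := by
  have hAh : A.IsHermitian := by
    simpa [Matrix.IsHermitian] using hA.eq
  have b1 : ∀ x, |quadForm A x - quadForm A₀ x| ≤ √c * ‖x‖ ^ 2 := fun x => by
    rw [← quadForm_sub]
    exact (abs_quadForm_le _ x).trans (by gcongr)
  have b2 : ∀ x, |quadForm A₀ x - quadForm A₁ x| ≤ δ * ‖x‖ ^ 2 := fun x => by
    rw [← quadForm_sub]
    exact (abs_quadForm_le _ x).trans (by gcongr)
  have hb1 : ∀ x : Covar p, √c * ‖x‖ ^ 2 ≤ δ * ‖x‖ ^ 2 := fun x => by gcongr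
  -- `A` is within `√c ≤ δ` of `A₀`, which is within `δ` of `A₁`: hence the `2 * δ` in `K`, and
  -- hence a bound `3 * δ` on `C` for `A₁` leaves `δ` for `A`.
  refine IsMRER.eq_of_bounds (K := entrySum A₁ + 2 * δ) hC (by simpa using C.finrank_le)
    hc hδ (fun j => ?_) (fun j h1 h2 => ?_) (fun j hj => ?_) hc1 hc2 h
  · refine abs_eigDesc_le hAh j (by have := entrySum_nonneg A₁; positivity) fun x => ?_
    have e1 := abs_le.1 (b1 x)
    have e2 := abs_le.1 (b2 x)
    have e3 := abs_le.1 (abs_quadForm_le A₁ x)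
    have e4 := hb1 x
    rw [abs_le]
    constructor <;> nlinarith
  · refine le_eigDesc hAh h1 (S := C) h2 fun x hx => ?_
    have e1 := abs_le.1 (b1 x)
    have e2 := abs_le.1 (b2 x)
    have e3 := hA₁ x hx
    have e4 := hb1 x
    nlinarith
  -- Past `dim C` the bound is `√c`, free of `δ`: from below `A₀` is nonnegative everywhere, from
  -- above it is zero on `Cᗮ`. The index `p + 1` falls under the convention that the eigenvalue is
  -- `0`.
  · by_cases hjp : j ≤ p
    · have hlo : -√c ≤ eigDesc A j := by
        refine le_eigDesc hAh (by omega) (S := ⊤) (by simpa using hjp) fun x _ => ?_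
        have e1 := abs_le.1 (b1 x)
        have e2 := hA₀ x
        linarith
      have hhi : eigDesc A j ≤ √c := by
        have hsum := C.finrank_add_finrank_orthogonal
        rw [finrank_euclideanSpace, Fintype.card_fin] at hsum
        refine eigDesc_le hAh (by omega) hjp (S := Cᗮ) (by omega) fun x hx => ?_
        have e1 := abs_le.1 (b1 x)
        have e2 := hA₀C x hx
        linarith
      exact (sq_le_sq' hlo hhi).trans_eq (Real.sq_sqrt hc.le)
    · rw [eigDesc, dif_neg (fun h => hjp h.2.2)]
      simpa using hc.le

/-! ### Conditional expectation and conditional independence. -/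

section CondExp

variable {α : Type*} {mα : MeasurableSpace α} {μ : Measure α}

theorem abs_indicator_one_le (s : Set α) (x : α) : |s.indicator (fun _ => (1 : ℝ)) x| ≤ 1 := by
  by_cases h : x ∈ s <;> simp [h]

theorem ae_abs_condExp_indicator_le (m : MeasurableSpace α) (s : Set α) :
    ∀ᵐ x ∂μ, |(μ⟦s|m⟧) x| ≤ 1 :=
  ae_bdd_abs_condExp_of_ae_bdd_abs (R := 1) (by
    exact ae_of_all _ fun x => by simpa using abs_indicator_one_le s x)

/-- For rational `r`, the integral of `f - g > 0` over `{g ≤ r < f}` is zero, so this event is null.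
Thus `f ≤ g` a.e., and the total integrals agree. -/
theorem ae_eq_of_forall_setIntegral_inter_eq {f g : α → ℝ} (hf : Measurable f) (hg : Measurable g)
    (hfi : Integrable f μ) (hgi : Integrable g μ)
    (h : ∀ s t : Set ℝ, MeasurableSet s → MeasurableSet t →
      ∫ x in f ⁻¹' s ∩ g ⁻¹' t, f x ∂μ = ∫ x in f ⁻¹' s ∩ g ⁻¹' t, g x ∂μ) : f =ᵐ[μ] g := by
  have hnull : ∀ r : ℚ, ∀ᵐ x ∂μ, ¬ (g x ≤ r ∧ (r : ℝ) < f x) := fun r => by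
    set A := f ⁻¹' Set.Ioi (r : ℝ) ∩ g ⁻¹' Set.Iic (r : ℝ) with hA
    have hAm : MeasurableSet A := (hf measurableSet_Ioi).inter (hg measurableSet_Iic)
    have h0 : ∫ x in A, (f x - g x) ∂μ = 0 := by
      rw [integral_sub hfi.integrableOn hgi.integrableOn,
        h _ _ measurableSet_Ioi measurableSet_Iic, sub_self]
    rw [setIntegral_eq_zero_iff_of_nonneg_ae] at h0
    · rw [Filter.EventuallyEq, ae_restrict_iff' hAm] at h0
      filter_upwards [h0] with x hx hx'
      have h1 : x ∈ A := ⟨hx'.2, hx'.1⟩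
      have h2 := hx h1
      simp only [Pi.zero_apply] at h2
      linarith [hx'.1, hx'.2]
    · refine (ae_restrict_iff' hAm).2 (ae_of_all _ fun x hx => ?_)
      have h1 : (r : ℝ) < f x := hx.1
      have h2 : g x ≤ r := hx.2
      simp only [Pi.zero_apply]
      linarith
    · exact (hfi.sub hgi).integrableOn
  have hle : ∀ᵐ x ∂μ, f x ≤ g x := by
    filter_upwards [ae_all_iff.2 hnull] with x hx
    by_contra hlt
    obtain ⟨r, h1, h2⟩ := exists_rat_btwn (not_le.1 hlt)
    exact hx r ⟨h1.le, h2⟩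
  have hint : ∫ x, (g x - f x) ∂μ = 0 := by
    have := h Set.univ Set.univ MeasurableSet.univ MeasurableSet.univ
    simp only [Set.preimage_univ, Set.inter_univ, setIntegral_univ] at this
    rw [integral_sub hgi hfi, this, sub_self]
  rw [integral_eq_zero_iff_of_nonneg_ae] at hint
  · filter_upwards [hint] with x hx
    simp only [Pi.zero_apply] at hx
    linarith
  · filter_upwards [hle] with x hx
    simpa using hx
  · exact hgi.sub hfi

variable [IsProbabilityMeasure μ]

theorem integral_mul_eq_integral_condExp_mul {m : MeasurableSpace α} (hm : m ≤ mα) {f h : α → ℝ}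
    (hh : StronglyMeasurable[m] h) (hf : Integrable f μ) (hfh : Integrable (f * h) μ) :
    ∫ x, f x * h x ∂μ = ∫ x, (μ[f|m]) x * h x ∂μ := by
  have h1 := integral_condExp (μ := μ) (f := f * h) hm
  rw [integral_congr_ae (condExp_mul_of_stronglyMeasurable_right hh hfh hf)] at h1
  exact h1.symm

theorem integrable_indicator_one {s : Set α} (hs : MeasurableSet s) :
    Integrable (s.indicator fun _ => (1 : ℝ)) μ :=
  (integrable_const 1).indicator hs

/-- With the next lemma, passes between the product form of conditional independence and `P(E | mX)
= P(E | m)`; the latter behaves well under limits and under enlarging `m`. -/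
theorem condExp_indicator_eq_of_forall_condExp_inter {m mX : MeasurableSpace α} (hmX : m ≤ mX)
    (hX : mX ≤ mα) {E : Set α} (hE : MeasurableSet[mα] E)
    (h : ∀ F, MeasurableSet[mX] F → μ⟦E ∩ F|m⟧ =ᵐ[μ] μ⟦E|m⟧ * μ⟦F|m⟧) :
    μ⟦E|mX⟧ =ᵐ[μ] μ⟦E|m⟧ := by
  symm
  refine ae_eq_condExp_of_forall_setIntegral_eq hX (integrable_indicator_one hE)
    (fun F _ _ => integrable_condExp.integrableOn) (fun F hF _ => ?_)
    (stronglyMeasurable_condExp.mono hmX).aestronglyMeasurable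
  have hF' := hX F hF
  have hint : Integrable ((F.indicator fun _ => (1 : ℝ)) * μ⟦E|m⟧) μ :=
    integrable_condExp.bdd_mul (integrable_indicator_one hF').aestronglyMeasurable
      (ae_of_all _ fun x => by simpa using abs_indicator_one_le F x)
  have h1 := integral_mul_eq_integral_condExp_mul (hmX.trans hX)
    (stronglyMeasurable_condExp (f := E.indicator fun _ => (1 : ℝ)) (μ := μ))
    (integrable_indicator_one hF') hint
  rw [← integral_indicator hF', ← integral_indicator hF']
  calc ∫ x, F.indicator (μ⟦E|m⟧) x ∂μ
      = ∫ x, F.indicator (fun _ => (1 : ℝ)) x * (μ⟦E|m⟧) x ∂μ := by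
        refine integral_congr_ae (ae_of_all _ fun x => ?_)
        by_cases hx : x ∈ F <;> simp [hx]
    _ = ∫ x, (μ⟦E ∩ F|m⟧) x ∂μ := by
        rw [h1]
        refine integral_congr_ae ?_
        filter_upwards [h F hF] with x hx
        rw [hx, Pi.mul_apply, mul_comm]
    _ = ∫ x, F.indicator (E.indicator fun _ => (1 : ℝ)) x ∂μ := by
        rw [integral_condExp (hmX.trans hX), Set.indicator_indicator, Set.inter_comm]

theorem condExp_inter_eq_mul_of_condExp_indicator_eq {m mX : MeasurableSpace α} (hmX : m ≤ mX)
    (hX : mX ≤ mα) {E F : Set α} (hE : MeasurableSet[mα] E) (hF : MeasurableSet[mX] F)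
    (h : μ⟦E|mX⟧ =ᵐ[μ] μ⟦E|m⟧) :
    μ⟦E ∩ F|m⟧ =ᵐ[μ] μ⟦E|m⟧ * μ⟦F|m⟧ := by
  have hF' := hX F hF
  have hint : Integrable (μ⟦E|m⟧ * (F.indicator fun _ => (1 : ℝ))) μ :=
    integrable_condExp.mul_bdd (integrable_indicator_one hF').aestronglyMeasurable
      (ae_of_all _ fun x => by simpa using abs_indicator_one_le F x)
  have h1 : μ⟦E ∩ F|mX⟧ =ᵐ[μ] μ⟦E|m⟧ * (F.indicator fun _ => (1 : ℝ)) := by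
    have := condExp_indicator (μ := μ) (integrable_indicator_one hE) hF
    rw [Set.indicator_indicator, Set.inter_comm] at this
    filter_upwards [this, h] with x hx hx'
    rw [hx]
    by_cases hxF : x ∈ F <;> simp [hxF, hx']
  calc μ⟦E ∩ F|m⟧ =ᵐ[μ] μ[μ⟦E ∩ F|mX⟧|m] := (condExp_condExp_of_le hmX hX).symm
    _ =ᵐ[μ] μ[μ⟦E|m⟧ * (F.indicator fun _ => (1 : ℝ))|m] := condExp_congr_ae h1
    _ =ᵐ[μ] μ⟦E|m⟧ * μ⟦F|m⟧ := condExp_mul_of_stronglyMeasurable_left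
        stronglyMeasurable_condExp hint (integrable_indicator_one hF')

theorem condExp_eq_of_le_of_condExp_eq {m m₁ mX : MeasurableSpace α} (hm : m ≤ m₁)
    (hm₁ : m₁ ≤ mX) (hX : mX ≤ mα) {f : α → ℝ} (h : μ[f|mX] =ᵐ[μ] μ[f|m]) :
    μ[f|mX] =ᵐ[μ] μ[f|m₁] := by
  have h1 : μ[f|m₁] =ᵐ[μ] μ[μ[f|m]|m₁] :=
    (condExp_condExp_of_le hm₁ hX).symm.trans (condExp_congr_ae h)
  rw [condExp_of_stronglyMeasurable (hm₁.trans hX) (stronglyMeasurable_condExp.mono hm)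
    integrable_condExp] at h1
  exact h.trans h1.symm

/-- The indicators converge in `L¹` by dominated convergence, and conditional expectation is an `L¹`
contraction. -/
theorem condExp_eq_of_tendsto {m₁ m₂ : MeasurableSpace α} {E : Set α} {s : ℕ → Set α}
    (hE : MeasurableSet[mα] E) (hs : ∀ n, MeasurableSet[mα] (s n))
    (hlim : ∀ᵐ x ∂μ, ∀ᶠ n in atTop, x ∈ s n ↔ x ∈ E)
    (h : ∀ n, μ⟦s n|m₁⟧ =ᵐ[μ] μ⟦s n|m₂⟧) : μ⟦E|m₁⟧ =ᵐ[μ] μ⟦E|m₂⟧ := by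
  set f : α → ℝ := E.indicator fun _ => 1 with hf
  set u : ℕ → α → ℝ := fun n => (s n).indicator fun _ => 1 with hu
  have hfi : Integrable f μ := integrable_indicator_one hE
  have hui : ∀ n, Integrable (u n) μ := fun n => integrable_indicator_one (hs n)
  have htend : Tendsto (fun n => ∫ x, |(f - u n) x| ∂μ) atTop (𝓝 0) := by
    rw [show (0 : ℝ) = ∫ _, (0 : ℝ) ∂μ by simp]
    refine tendsto_integral_of_dominated_convergence (fun _ => 2)
      (fun n => (hfi.sub (hui n)).abs.aestronglyMeasurable) (integrable_const _)
      (fun n => ae_of_all _ fun x => ?_) ?_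
    · have h1 := abs_indicator_one_le E x
      have h2 := abs_indicator_one_le (s n) x
      have := abs_sub (f x) (u n x)
      rw [Real.norm_eq_abs, abs_abs, Pi.sub_apply]
      simp only [hf, hu] at this ⊢
      linarith
    · filter_upwards [hlim] with x hx
      refine tendsto_const_nhds.congr' ?_
      filter_upwards [hx] with n hn
      by_cases hxE : x ∈ E <;> simp [hf, hu, hxE, hn]
  have hbound : ∀ n, ∫ x, |(μ[f|m₁] - μ[f|m₂]) x| ∂μ ≤ 2 * ∫ x, |(f - u n) x| ∂μ := fun n => by
    have e1 := condExp_sub (μ := μ) hfi (hui n) m₁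
    have e2 := condExp_sub (μ := μ) hfi (hui n) m₂
    have i1 : Integrable (fun x => |(μ[f - u n|m₁]) x|) μ := integrable_condExp.abs
    have i2 : Integrable (fun x => |(μ[f - u n|m₂]) x|) μ := integrable_condExp.abs
    calc ∫ x, |(μ[f|m₁] - μ[f|m₂]) x| ∂μ
        ≤ ∫ x, (|(μ[f - u n|m₁]) x| + |(μ[f - u n|m₂]) x|) ∂μ := by
          refine integral_mono_ae (integrable_condExp.sub integrable_condExp).abs (i1.add i2) ?_
          filter_upwards [e1, e2, h n] with x h1 h2 h3
          rw [h1, h2]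
          simp only [Pi.sub_apply]
          rw [h3]
          refine le_trans (le_of_eq ?_) (abs_sub _ _)
          congr 1; ring
      _ ≤ 2 * ∫ x, |(f - u n) x| ∂μ := by
          rw [integral_add i1 i2]
          have b1 := integral_abs_condExp_le (μ := μ) (m := m₁) (f - u n)
          have b2 := integral_abs_condExp_le (μ := μ) (m := m₂) (f - u n)
          linarith
  have hle : ∫ x, |(μ[f|m₁] - μ[f|m₂]) x| ∂μ ≤ 0 :=
    ge_of_tendsto' (by simpa using htend.const_mul 2) hbound
  have h0 := le_antisymm hle (integral_nonneg fun _ => abs_nonneg _)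
  rw [integral_eq_zero_iff_of_nonneg (fun _ => abs_nonneg _)
    (integrable_condExp.sub integrable_condExp).abs] at h0
  filter_upwards [h0] with x hx
  have : (μ[f|m₁]) x - (μ[f|m₂]) x = 0 := by simpa using hx
  linarith

/-- If `Y` and the event `F` are conditionally independent given `m`, the expectation of `Y` over
`F` can be computed with `E(Y | m)`. -/
theorem setIntegral_inter_eq_setIntegral_condExp {m : MeasurableSpace α} (hm : m ≤ mα)
    {Y : α → ℝ} (hYm : Measurable[mα] Y) (hY : Integrable Y μ) {F G : Set α} (hF : MeasurableSet[mα] F)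
    (hG : MeasurableSet[m] G)
    (h : ∀ s, MeasurableSet s → μ⟦Y ⁻¹' s ∩ F|m⟧ =ᵐ[μ] μ⟦Y ⁻¹' s|m⟧ * μ⟦F|m⟧) :
    ∫ x in F ∩ G, Y x ∂μ = ∫ x in F ∩ G, (μ[Y|m]) x ∂μ := by
  have hG' := hm G hG
  set φ := μ⟦F|m⟧ with hφ
  have hφb : ∀ᵐ x ∂μ, |G.indicator φ x| ≤ 1 := by
    filter_upwards [ae_abs_condExp_indicator_le m F] with x hx
    by_cases hxG : x ∈ G <;> simp [hxG, hx, hφ]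
  have hφs : StronglyMeasurable[m] (G.indicator φ) := stronglyMeasurable_condExp.indicator hG
  have hφi : Integrable (G.indicator φ) μ := integrable_condExp.indicator hG'
  have hind : ∀ f : α → ℝ, Integrable f μ → Integrable (f * G.indicator φ) μ := fun f hf =>
    hf.mul_bdd hφi.aestronglyMeasurable (by simpa using hφb)
  have hFG := hF.inter hG'
  -- conditionally on `Y`, the indicator of `F ∩ G` may be replaced by `1_G P(F | m)`
  have key : μ⟦F ∩ G|MeasurableSpace.comap Y inferInstance⟧ =ᵐ[μ]
      μ[G.indicator φ|MeasurableSpace.comap Y inferInstance] := by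
    symm
    refine ae_eq_condExp_of_forall_setIntegral_eq hYm.comap_le (integrable_indicator_one hFG)
      (fun _ _ _ => integrable_condExp.integrableOn) ?_
      stronglyMeasurable_condExp.aestronglyMeasurable
    rintro _ ⟨s, hs, rfl⟩ -
    have hA := hYm hs
    rw [setIntegral_condExp hYm.comap_le hφi ⟨s, hs, rfl⟩]
    calc ∫ x in Y ⁻¹' s, G.indicator φ x ∂μ
        = ∫ x, (Y ⁻¹' s).indicator (fun _ => (1 : ℝ)) x * G.indicator φ x ∂μ := by
          rw [← integral_indicator hA]
          refine integral_congr_ae (ae_of_all _ fun x => ?_)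
          by_cases hx : x ∈ Y ⁻¹' s <;> simp [Set.indicator, hx]
      _ = ∫ x, (μ⟦Y ⁻¹' s|m⟧) x * G.indicator φ x ∂μ :=
          integral_mul_eq_integral_condExp_mul hm hφs (integrable_indicator_one hA)
            (hind _ (integrable_indicator_one hA))
      _ = ∫ x in G, (μ⟦Y ⁻¹' s ∩ F|m⟧) x ∂μ := by
          rw [← integral_indicator hG']
          refine integral_congr_ae ?_
          filter_upwards [h s hs] with x hx
          by_cases hxG : x ∈ G <;> simp [hxG, hx, hφ]
      _ = ∫ x in G, (Y ⁻¹' s ∩ F).indicator (fun _ => (1 : ℝ)) x ∂μ :=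
          setIntegral_condExp hm (integrable_indicator_one (hA.inter hF)) hG
      _ = ∫ x in Y ⁻¹' s, (F ∩ G).indicator (fun _ => (1 : ℝ)) x ∂μ := by
          rw [← integral_indicator hG', ← integral_indicator hA, Set.indicator_indicator,
            Set.indicator_indicator]
          rw [Set.inter_comm F G, Set.inter_left_comm]
  have hYs : StronglyMeasurable[MeasurableSpace.comap Y inferInstance] Y :=
    (comap_measurable Y).stronglyMeasurable
  have hFGY : Integrable (((F ∩ G).indicator fun _ => (1 : ℝ)) * Y) μ :=
    hY.bdd_mul (integrable_indicator_one hFG).aestronglyMeasurable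
      (ae_of_all _ fun x => by simpa using abs_indicator_one_le (F ∩ G) x)
  have hGe : Integrable (G.indicator (μ[Y|m])) μ := integrable_condExp.indicator hG'
  -- Conditioning on `Y` trades the indicator of `F ∩ G` for `1_G φ`; conditioning on `m` then
  -- trades `Y` for `E(Y | m)` and `φ` back for the indicator of `F`. No approximation of `Y` by
  -- simple functions is needed.
  calc ∫ x in F ∩ G, Y x ∂μ = ∫ x, (F ∩ G).indicator (fun _ => (1 : ℝ)) x * Y x ∂μ := by
        rw [← integral_indicator hFG]
        refine integral_congr_ae (ae_of_all _ fun x => ?_)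
        by_cases hx : x ∈ F ∩ G <;> simp [Set.indicator, hx]
    _ = ∫ x, G.indicator φ x * Y x ∂μ := by
        rw [integral_mul_eq_integral_condExp_mul hYm.comap_le hYs (integrable_indicator_one hFG)
          hFGY, integral_mul_eq_integral_condExp_mul hYm.comap_le hYs hφi
          (by simpa [mul_comm] using hind Y hY)]
        refine integral_congr_ae ?_
        filter_upwards [key] with x hx
        rw [hx]
    _ = ∫ x, (μ[Y|m]) x * G.indicator φ x ∂μ := by
        rw [← integral_mul_eq_integral_condExp_mul hm hφs hY (hind Y hY)]
        exact integral_congr_ae (ae_of_all _ fun x => mul_comm _ _)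
    _ = ∫ x, φ x * G.indicator (μ[Y|m]) x ∂μ := by
        refine integral_congr_ae (ae_of_all _ fun x => ?_)
        by_cases hx : x ∈ G <;> simp [hx, mul_comm]
    _ = ∫ x, F.indicator (fun _ => (1 : ℝ)) x * G.indicator (μ[Y|m]) x ∂μ := by
        rw [integral_mul_eq_integral_condExp_mul hm (stronglyMeasurable_condExp.indicator hG)
          (integrable_indicator_one hF)]
        exact hGe.bdd_mul (integrable_indicator_one hF).aestronglyMeasurable
          (ae_of_all _ fun x => by simpa using abs_indicator_one_le F x)
    _ = ∫ x in F ∩ G, (μ[Y|m]) x ∂μ := by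
        rw [← integral_indicator hFG]
        refine integral_congr_ae (ae_of_all _ fun x => ?_)
        by_cases hx : x ∈ F <;> by_cases hx' : x ∈ G <;> simp [hx, hx']

end CondExp

/-! ### Dimension reduction subspaces for `Y`, `Z(t)` and `E(Y | X)`. -/

/-- The σ-algebra on the observation space generated by the covariates. -/
@[reducible] def covSigma (p : ℕ) : MeasurableSpace (Obs p) :=
  MeasurableSpace.comap (Prod.fst : Obs p → Covar p) inferInstance

theorem covSigma_le (p : ℕ) : covSigma p ≤ (inferInstance : MeasurableSpace (Obs p)) :=
  measurable_fst.comap_le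

theorem projSigma_le_covSigma {p : ℕ} (S : Submodule ℝ (Covar p)) : projSigma S ≤ covSigma p := by
  rintro _ ⟨s, hs, rfl⟩
  exact ⟨_, S.starProjection.continuous.measurable hs, rfl⟩

theorem projSigma_mono {p : ℕ} {S T : Submodule ℝ (Covar p)} (h : S ≤ T) :
    projSigma S ≤ projSigma T := by
  rintro _ ⟨s, hs, rfl⟩
  refine ⟨_, S.starProjection.continuous.measurable hs, ?_⟩
  ext z
  have := congrArg (fun f => f z.1) (Submodule.starProjection_comp_starProjection_of_le h)
  simp only [ContinuousLinearMap.comp_apply] at this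
  simp only [Set.mem_preimage, this]

theorem measurable_discretized {p : ℕ} (t : ℝ) : Measurable (discretized t : Obs p → ℝ) :=
  measurable_one.indicator (measurable_snd measurableSet_Iic)

theorem discretized_eq_comp {p : ℕ} (t : ℝ) :
    (discretized t : Obs p → ℝ) = (Set.Iic t).indicator 1 ∘ Prod.snd := by
  ext z
  by_cases h : z.2 ≤ t <;> simp [discretized, h]

theorem discretized_preimage_singleton_one {p : ℕ} (t : ℝ) :
    (discretized t : Obs p → ℝ) ⁻¹' {1} = {z | z.2 ≤ t} := by
  ext z
  by_cases h : z.2 ≤ t <;> simp [discretized, h]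

section DimensionReduction

variable {p : ℕ} {P : Measure (Obs p)}

theorem stronglyMeasurable_condMean : StronglyMeasurable[covSigma p] (condMean P) :=
  stronglyMeasurable_condExp

theorem measurable_condMean : Measurable (condMean P) :=
  (stronglyMeasurable_condMean.mono (covSigma_le p)).measurable

variable [IsProbabilityMeasure P]

theorem IsDimReduction.condExp_eq {W : Obs p → ℝ} (hW : Measurable W)
    {S : Submodule ℝ (Covar p)} (h : IsDimReduction P W S) {s : Set ℝ} (hs : MeasurableSet s) :
    P⟦W ⁻¹' s|covSigma p⟧ =ᵐ[P] P⟦W ⁻¹' s|projSigma S⟧ := by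
  rw [IsDimReduction, condIndepFun_iff _ _ _ _ hW measurable_fst] at h
  exact condExp_indicator_eq_of_forall_condExp_inter (projSigma_le_covSigma S) (covSigma_le p)
    (hW hs) fun F hF => h _ _ ⟨s, hs, rfl⟩ hF

theorem isDimReduction_snd_of_condExp_eq {S : Submodule ℝ (Covar p)}
    (h : ∀ t : ℝ, P⟦{z | z.2 ≤ t}|covSigma p⟧ =ᵐ[P] P⟦{z | z.2 ≤ t}|projSigma S⟧) :
    IsDimReduction P (Prod.snd : Obs p → ℝ) S := by
  rw [IsDimReduction, condIndepFun_iff_condIndep]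
  refine CondIndepSets.condIndep (p1 := {s | ∃ t ∈ Set.range (Set.Iic : ℝ → Set ℝ),
      (Prod.snd : Obs p → ℝ) ⁻¹' t = s}) (p2 := {s | MeasurableSet[covSigma p] s})
    measurable_snd.comap_le measurable_fst.comap_le (isPiSystem_Iic.comap _)
    (@MeasurableSpace.isPiSystem_measurableSet _ (covSigma p)) ?_
    (@MeasurableSpace.generateFrom_measurableSet _ (covSigma p)).symm ?_
  · rw [BorelSpace.measurable_eq (α := ℝ), borel_eq_generateFrom_Iic,
      MeasurableSpace.comap_generateFrom]
    rfl
  · rw [condIndepSets_iff]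
    · rintro _ F ⟨_, ⟨t, rfl⟩, rfl⟩ hF
      exact condExp_inter_eq_mul_of_condExp_indicator_eq (projSigma_le_covSigma S) (covSigma_le p)
        (measurable_snd measurableSet_Iic) hF (h t)
    · rintro _ ⟨_, ⟨t, rfl⟩, rfl⟩
      exact measurable_snd measurableSet_Iic
    · exact fun F hF => covSigma_le p F hF

theorem IsDimReduction.discretized {S : Submodule ℝ (Covar p)}
    (h : IsDimReduction P (Prod.snd : Obs p → ℝ) S) (t : ℝ) :
    IsDimReduction P (discretized t) S := by
  rw [discretized_eq_comp]
  exact CondIndepFun.comp (ψ := id) h (measurable_one.indicator measurableSet_Iic) measurable_id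

theorem centralSubspace_discretized_le (t : ℝ) :
    centralSubspace P (discretized t) ≤ centralSubspace P (Prod.snd : Obs p → ℝ) :=
  sInf_le_sInf fun _ h => h.discretized t

/-- Take a sequence in `D ∩ Iic t` increasing to its supremum, or constant if the supremum is
attained. When `Y ∈ D` a.s., the events `{Y ≤ u n}` then converge a.s. to `{Y ≤ t}`, although `t`
itself may lie outside `D`. -/
theorem exists_seq_eventually_le {D : Set ℝ} {t : ℝ} (h : (D ∩ Set.Iic t).Nonempty) :
    ∃ u : ℕ → ℝ, (∀ n, u n ∈ D ∧ u n ≤ t) ∧ ∀ y ∈ D, y ≤ t → ∀ᶠ n in atTop, y ≤ u n := by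
  have hb : BddAbove (D ∩ Set.Iic t) := ⟨t, fun x hx => hx.2⟩
  by_cases hs : sSup (D ∩ Set.Iic t) ∈ D ∩ Set.Iic t
  · exact ⟨fun _ => sSup (D ∩ Set.Iic t), fun _ => hs,
      fun y hy hyt => Eventually.of_forall fun _ => le_csSup hb ⟨hy, hyt⟩⟩
  · obtain ⟨u, -, hu, hmem⟩ := exists_seq_tendsto_sSup h hb
    refine ⟨u, fun n => hmem n, fun y hy hyt => ?_⟩
    have hlt : y < sSup (D ∩ Set.Iic t) :=
      lt_of_le_of_ne (le_csSup hb ⟨hy, hyt⟩) fun he => hs (he ▸ ⟨hy, hyt⟩)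
    filter_upwards [hu.eventually (lt_mem_nhds hlt)] with n hn using hn.le

/-- A subspace that contains the central subspace of `Z(t) | X` for almost every value `t` of `Y`
is a dimension reduction subspace for `Y | X`. -/
theorem isDimReduction_snd_of_ae_le
    (hexist : ∀ t, IsDimReduction P (discretized t) (centralSubspace P (discretized t)))
    {S : Submodule ℝ (Covar p)} (h : ∀ᵐ z ∂P, centralSubspace P (discretized z.2) ≤ S) :
    IsDimReduction P (Prod.snd : Obs p → ℝ) S := by
  -- The good thresholds. The hypothesis says `Y ∈ D` a.s., but dimension reduction for `Y` involves
  -- every `t`, so the others are reached by limits from within `D`.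
  set D : Set ℝ := {t | centralSubspace P (discretized t) ≤ S} with hD
  have hset : ∀ t : ℝ, MeasurableSet {z : Obs p | z.2 ≤ t} := fun t =>
    measurable_snd measurableSet_Iic
  have hmem : ∀ t ∈ D, P⟦{z | z.2 ≤ t}|covSigma p⟧ =ᵐ[P] P⟦{z | z.2 ≤ t}|projSigma S⟧ := by
    intro t ht
    have := (hexist t).condExp_eq (measurable_discretized t) (measurableSet_singleton 1)
    rw [discretized_preimage_singleton_one] at this
    exact condExp_eq_of_le_of_condExp_eq (projSigma_mono ht) (projSigma_le_covSigma S)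
      (covSigma_le p) this
  refine isDimReduction_snd_of_condExp_eq fun t => ?_
  by_cases hne : (D ∩ Set.Iic t).Nonempty
  · obtain ⟨u, hu, hev⟩ := exists_seq_eventually_le hne
    refine condExp_eq_of_tendsto (s := fun n => {z | z.2 ≤ u n}) (hset t) (fun n => hset (u n))
      ?_ fun n => hmem _ (hu n).1
    filter_upwards [h] with z hz
    by_cases hzt : z.2 ≤ t
    · filter_upwards [hev z.2 hz hzt] with n hn
      simp [hn, hzt]
    · refine Eventually.of_forall fun n => ?_
      have : ¬ z.2 ≤ u n := fun h' => hzt (h'.trans (hu n).2)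
      simp [this, hzt]
  -- With no good threshold up to `t`, the event `{Y ≤ t}` is null and may be replaced by `∅`.
  · refine condExp_eq_of_tendsto (s := fun _ => ∅) (hset t) (fun _ => MeasurableSet.empty) ?_
      fun _ => by
        simp only [Set.indicator_empty]
        rw [condExp_const (covSigma_le p), condExp_const (projSigma_le S)]
    filter_upwards [h] with z hz
    have : ¬ z.2 ≤ t := fun hzt => hne ⟨z.2, hz, hzt⟩
    simp [this]

theorem IsDimReduction.isMeanDimReduction {S : Submodule ℝ (Covar p)}
    (h : IsDimReduction P (Prod.snd : Obs p → ℝ) S) : IsMeanDimReduction P S := by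
  obtain ⟨φ, hφ, heq⟩ := (stronglyMeasurable_condMean (P := P)).exists_eq_measurable_comp
  rw [IsMeanDimReduction, heq]
  exact CondIndepFun.comp (φ := id) h measurable_id hφ.measurable

/-- On events `{E(Y|X) ∈ s} ∩ {E(Y|P_S X) ∈ t}`, which lie in `σ(X)`, `E(Y|X)` integrates like `Y`
by definition, and `E(Y|P_S X)` does so by conditional independence. Such events suffice for a.e.
equality. -/
theorem IsMeanDimReduction.condMean_eq (hY : Integrable (Prod.snd : Obs p → ℝ) P)
    {S : Submodule ℝ (Covar p)} (h : IsMeanDimReduction P S) :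
    condMean P =ᵐ[P] P[(Prod.snd : Obs p → ℝ)|projSigma S] := by
  have he : StronglyMeasurable[projSigma S] (P[(Prod.snd : Obs p → ℝ)|projSigma S]) :=
    stronglyMeasurable_condExp
  rw [IsMeanDimReduction, condIndepFun_iff _ _ _ _ measurable_snd measurable_condMean] at h
  refine ae_eq_of_forall_setIntegral_inter_eq measurable_condMean
    (he.mono (projSigma_le S)).measurable integrable_condExp integrable_condExp
    fun s t hs ht => ?_
  rw [← setIntegral_inter_eq_setIntegral_condExp (projSigma_le S) measurable_snd hY
    (measurable_condMean hs) (he.measurable ht) fun r hr => h _ _ ⟨r, hr, rfl⟩ ⟨s, hs, rfl⟩]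
  refine setIntegral_condExp (covSigma_le p) hY ?_
  exact MeasurableSet.inter (stronglyMeasurable_condMean.measurable hs)
    (projSigma_le_covSigma S _ (he.measurable ht))

/-- A variable measurable for the conditioning σ-algebra is conditionally independent of anything;
it remains to absorb the null set where it differs from `E(Y|X)`. -/
theorem isMeanDimReduction_of_condMean_eq {S : Submodule ℝ (Covar p)} {f : Obs p → ℝ}
    (hf : Measurable[projSigma S] f) (h : condMean P =ᵐ[P] f) : IsMeanDimReduction P S := by
  have hfm : Measurable f := hf.mono (projSigma_le S) le_rfl
  have h1 : CondIndepFun (projSigma S) (projSigma_le S) (Prod.snd : Obs p → ℝ) f P :=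
    condIndepFun_of_measurable_right measurable_snd hf
  rw [IsMeanDimReduction, condIndepFun_iff_condExp_inter_preimage_eq_mul measurable_snd
    measurable_condMean]
  rw [condIndepFun_iff_condExp_inter_preimage_eq_mul measurable_snd hfm] at h1
  intro s t hs ht
  have e : condMean P ⁻¹' t =ᵐ[P] f ⁻¹' t := by
    filter_upwards [h] with z hz
    change (condMean P z ∈ t) = (f z ∈ t)
    rw [hz]
  have e1 := condExp_congr_ae (m := projSigma S)
    (indicator_ae_eq_of_ae_eq_set (f := fun _ => (1 : ℝ)) e)
  have e2 := condExp_congr_ae (m := projSigma S)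
    (indicator_ae_eq_of_ae_eq_set (f := fun _ => (1 : ℝ))
      ((EventuallyEq.refl _ (Prod.snd ⁻¹' s)).inter e))
  filter_upwards [e1, e2, h1 s t hs ht] with z h1 h2 h3
  rw [h2, h3, h1]

/-- `x ↦ Bᵀ x` as a linear map. -/
def transposeLin {r : ℕ} (B : Matrix (Fin p) (Fin r) ℝ) : Covar p →ₗ[ℝ] Covar r :=
  Matrix.toEuclideanLin B.transpose

theorem transposeLin_apply {r : ℕ} (B : Matrix (Fin p) (Fin r) ℝ) (x : Covar p) :
    transposeLin B x = transposeApply B x := by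
  simp [transposeLin, transposeApply, Matrix.toLpLin_apply]

theorem measurable_transposeApply {r : ℕ} (B : Matrix (Fin p) (Fin r) ℝ) :
    Measurable (transposeApply B) := by
  have : transposeApply B = transposeLin B := funext fun x => (transposeLin_apply B x).symm
  rw [this]
  exact (LinearMap.continuous_of_finiteDimensional _).measurable

theorem transposeApply_apply {r : ℕ} (B : Matrix (Fin p) (Fin r) ℝ) (x : Covar p) (k : Fin r) :
    transposeApply B x k = inner ℝ (WithLp.toLp 2 (B.col k) : Covar p) x := by
  simp [transposeApply, Matrix.mulVec, EuclideanSpace.inner_eq_star_dotProduct, dotProduct,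
    Matrix.col, mul_comm]

theorem IsMultiIndex.exists_isMeanDimReduction {r : ℕ} {B : Matrix (Fin p) (Fin r) ℝ}
    (h : IsMultiIndex P B) :
    ∃ S : Submodule ℝ (Covar p), Module.finrank ℝ S ≤ r ∧ IsMeanDimReduction P S := by
  obtain ⟨G, hG, hGeq⟩ := h
  -- This is the span of the columns of `B`: `Bᵀ x` is unchanged when `x` is projected on it, and
  -- its dimension is the rank of `B`.
  refine ⟨(LinearMap.ker (transposeLin B))ᗮ, ?_, ?_⟩
  · have h1 := (LinearMap.ker (transposeLin B)).finrank_add_finrank_orthogonal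
    have h2 := (transposeLin B).finrank_range_add_finrank_ker
    have h3 := (LinearMap.range (transposeLin B)).finrank_le
    simp only [finrank_euclideanSpace, Fintype.card_fin] at h1 h2 h3
    omega
  · refine isMeanDimReduction_of_condMean_eq (f := fun z => G (transposeApply B
      ((LinearMap.ker (transposeLin B))ᗮ.starProjection z.1))) ?_ ?_
    · exact (hG.comp (measurable_transposeApply B)).comp (comap_measurable _)
    · filter_upwards [hGeq] with z hz
      rw [hz]
      congr 1
      have hmem : z.1 - (LinearMap.ker (transposeLin B))ᗮ.starProjection z.1 ∈
          LinearMap.ker (transposeLin B) := by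
        have := Submodule.sub_starProjection_mem_orthogonal
          (K := (LinearMap.ker (transposeLin B))ᗮ) z.1
        rwa [Submodule.orthogonal_orthogonal] at this
      rw [LinearMap.mem_ker, map_sub, sub_eq_zero] at hmem
      simpa only [transposeLin_apply] using hmem

theorem IsMeanDimReduction.exists_isMultiIndex (hY : Integrable (Prod.snd : Obs p → ℝ) P)
    {S : Submodule ℝ (Covar p)} (h : IsMeanDimReduction P S) :
    ∃ B : Matrix (Fin p) (Fin (Module.finrank ℝ S)) ℝ, IsMultiIndex P B := by
  have heq := h.condMean_eq hY
  obtain ⟨φ, hφ, hφeq⟩ := StronglyMeasurable.exists_eq_measurable_comp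
    (stronglyMeasurable_condExp (m := projSigma S) (μ := P) (f := (Prod.snd : Obs p → ℝ)))
  rw [hφeq] at heq
  let b := stdOrthonormalBasis ℝ S
  -- With an orthonormal basis of `S` as columns, `Bᵀ x` lists the coordinates of `P_S x`, from
  -- which `P_S x` is rebuilt.
  refine ⟨Matrix.of fun i k => (b k : Covar p) i,
    fun y => φ (∑ k, y k • (b k : Covar p)), ?_, ?_⟩
  · refine hφ.measurable.comp ?_
    exact Continuous.measurable (by fun_prop)
  · filter_upwards [heq] with z hz
    rw [hz, Function.comp_apply]
    congr 1
    have h1 := b.sum_repr (S.orthogonalProjectionOnto z.1)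
    have h2 := congrArg (Subtype.val) h1
    rw [Submodule.starProjection_apply, ← h2]
    simp only [AddSubmonoidClass.coe_finsetSum, Submodule.coe_smul]
    refine Finset.sum_congr rfl fun k _ => ?_
    congr 1
    rw [transposeApply_apply, b.repr_apply_apply,
      Submodule.inner_orthogonalProjectionOnto_eq_of_mem_left]
    rfl

end DimensionReduction

/-! ### Events of vanishing probability. -/

section Markov

variable {Ω : Type*} [MeasurableSpace Ω] {μ : Measure Ω}

theorem tendsto_measure_union {s t : ℕ → Set Ω} (hs : Tendsto (fun n => μ (s n)) atTop (𝓝 0))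
    (ht : Tendsto (fun n => μ (t n)) atTop (𝓝 0)) :
    Tendsto (fun n => μ (s n ∪ t n)) atTop (𝓝 0) :=
  tendsto_of_tendsto_of_tendsto_of_le_of_le tendsto_const_nhds (by simpa using hs.add ht)
    (fun _ => zero_le) fun _ => measure_union_le _ _

theorem tendsto_measure_iUnion_fintype {ι : Type*} [Fintype ι] {s : ι → ℕ → Set Ω}
    (hs : ∀ i, Tendsto (fun n => μ (s i n)) atTop (𝓝 0)) :
    Tendsto (fun n => μ (⋃ i, s i n)) atTop (𝓝 0) :=
  tendsto_of_tendsto_of_tendsto_of_le_of_le tendsto_const_nhds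
    (by simpa using tendsto_finsetSum Finset.univ fun i _ => hs i)
    (fun _ => zero_le) fun _ => measure_iUnion_fintype_le _ _

variable [IsProbabilityMeasure μ]

theorem tendsto_measure_ge_of_integral_le {X : ℕ → Ω → ℝ} {a r : ℕ → ℝ} (hX0 : ∀ n ω, 0 ≤ X n ω)
    (hXi : ∀ n, Integrable (X n) μ) (hle : ∀ n, ∫ ω, X n ω ∂μ ≤ a n) (hr : ∀ᶠ n in atTop, 0 < r n)
    (h : Tendsto (fun n => a n / r n) atTop (𝓝 0)) :
    Tendsto (fun n => μ {ω | r n ≤ X n ω}) atTop (𝓝 0) := by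
  have h' : Tendsto (fun n => ENNReal.ofReal (a n / r n)) atTop (𝓝 0) := by
    simpa using ENNReal.tendsto_ofReal h
  refine tendsto_of_tendsto_of_tendsto_of_le_of_le' tendsto_const_nhds h'
    (Eventually.of_forall fun _ => zero_le) ?_
  filter_upwards [hr] with n hn
  have := mul_meas_ge_le_integral_of_nonneg (ae_of_all _ (hX0 n)) (hXi n) (r n)
  rw [← ENNReal.ofReal_toReal (measure_ne_top μ {ω | r n ≤ X n ω})]
  refine ENNReal.ofReal_le_ofReal ?_
  rw [le_div_iff₀ hn, mul_comm]
  exact this.trans (hle n)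

/-- Only subadditivity is used, so the sets need not be measurable; `q̂` is an arbitrary selection
of minimizers. -/
theorem tendsto_measure_one_of_compl {s : ℕ → Set Ω}
    (h : Tendsto (fun n => μ (s n)ᶜ) atTop (𝓝 0)) : Tendsto (fun n => μ (s n)) atTop (𝓝 1) := by
  have h1 : Tendsto (fun n => 1 - μ (s n)ᶜ) atTop (𝓝 1) := by
    simpa using ENNReal.Tendsto.sub tendsto_const_nhds h (Or.inl ENNReal.one_ne_top)
  refine tendsto_of_tendsto_of_tendsto_of_le_of_le h1 tendsto_const_nhds (fun n => ?_)
    fun n => prob_le_one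
  rw [tsub_le_iff_right]
  calc (1 : ENNReal) = μ (s n ∪ (s n)ᶜ) := by rw [Set.union_compl_self, measure_univ]
    _ ≤ _ := measure_union_le _ _

end Markov

/-! ### Double sums over the sample, and averages. -/

section VStatistic

variable {p : ℕ} {Ω : Type*} [MeasurableSpace Ω] {μ : Measure Ω}
  {P : Measure (Obs p)} {Z : ℕ → Ω → Obs p}

theorem IsIIDSample.measurePreserving (hZ : IsIIDSample μ P Z) (i : ℕ) :
    MeasurePreserving (Z i) μ P := ⟨hZ.measurable i, hZ.law i⟩

variable [IsProbabilityMeasure μ]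

theorem IsIIDSample.measurePreserving_prodMk_snd (hZ : IsIIDSample μ P Z) {i j : ℕ} (hij : j ≠ i) :
    MeasurePreserving (fun ω => (Z j ω, (Z i ω).2)) μ
      (P.prod (P.map (Prod.snd : Obs p → ℝ))) := by
  have h1 := hZ.measurable j
  have h2 : Measurable fun ω => (Z i ω).2 := measurable_snd.comp (hZ.measurable i)
  refine ⟨h1.prodMk h2, ?_⟩
  have hind : Z j ⟂ᵢ[μ] fun ω => (Z i ω).2 :=
    (hZ.indep.indepFun hij).comp measurable_id measurable_snd
  rw [(indepFun_iff_map_prod_eq_prod_map_map h1.aemeasurable h2.aemeasurable).1 hind, hZ.law j,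
    show (fun ω => (Z i ω).2) = Prod.snd ∘ Z i from rfl,
    ← Measure.map_map measurable_snd (hZ.measurable i), hZ.law i]

theorem IsIIDSample.measurePreserving_prodMk_prodMk_snd (hZ : IsIIDSample μ P Z) {i j l : ℕ}
    (hij : j ≠ i) (hlj : l ≠ j) (hli : l ≠ i) :
    MeasurePreserving (fun ω => (Z l ω, (Z j ω, (Z i ω).2))) μ
      (P.prod (P.prod (P.map (Prod.snd : Obs p → ℝ)))) := by
  have h2 := hZ.measurePreserving_prodMk_snd hij
  have h1 := hZ.measurable l
  refine ⟨h1.prodMk h2.measurable, ?_⟩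
  have hind : Z l ⟂ᵢ[μ] fun ω => (Z j ω, (Z i ω).2) :=
    ((hZ.indep.indepFun_prodMk hZ.measurable j i l hlj.symm hli.symm).comp
      (measurable_fst.prodMk (measurable_snd.comp measurable_snd)) measurable_id).symm
  rw [(indepFun_iff_map_prod_eq_prod_map_map h1.aemeasurable h2.measurable.aemeasurable).1 hind,
    hZ.law l, h2.map_eq]

/-- For three distinct indices, integrating over `Z l` first, with `Z j` and the response of `Z i`
fixed, gives zero by centring. -/
theorem IsIIDSample.integral_mul_eq_zero [IsProbabilityMeasure P]
    (hZ : IsIIDSample μ P Z) {f : Obs p × ℝ → ℝ}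
    (hf : MemLp f 2 (P.prod (P.map (Prod.snd : Obs p → ℝ)))) (hf0 : ∀ t, ∫ z, f (z, t) ∂P = 0)
    {i j l : ℕ} (hij : j ≠ i) (hlj : l ≠ j) (hli : l ≠ i) :
    ∫ ω, f (Z l ω, (Z i ω).2) * f (Z j ω, (Z i ω).2) ∂μ = 0 := by
  set ν := P.map (Prod.snd : Obs p → ℝ) with hν
  have hmp := hZ.measurePreserving_prodMk_prodMk_snd hij hlj hli
  have hsnd : MeasurePreserving (Prod.snd : Obs p × (Obs p × ℝ) → Obs p × ℝ)
      (P.prod (P.prod ν)) (P.prod ν) := measurePreserving_snd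
  have hfst : MeasurePreserving (fun w : Obs p × (Obs p × ℝ) => (w.1, w.2.2))
      (P.prod (P.prod ν)) (P.prod ν) :=
    (MeasurePreserving.id P).prod measurePreserving_snd
  have hint : Integrable (fun w : Obs p × (Obs p × ℝ) => f (w.1, w.2.2) * f w.2)
      (P.prod (P.prod ν)) :=
    (hf.comp_measurePreserving hfst).integrable_mul (hf.comp_measurePreserving hsnd)
  have h1 := integral_map (μ := μ) hmp.measurable.aemeasurable
    (f := fun w : Obs p × (Obs p × ℝ) => f (w.1, w.2.2) * f w.2)
    (by rw [hmp.map_eq]; exact hint.aestronglyMeasurable)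
  rw [← h1, hmp.map_eq, integral_prod_symm _ hint]
  simp [integral_mul_const, hf0]

/-- The sum of `f (Z j, Y i)` over the pairs `i ≠ j`. -/
def offDiagSum (Z : ℕ → Ω → Obs p) (f : Obs p × ℝ → ℝ) (n : ℕ) (ω : Ω) : ℝ :=
  ∑ i ∈ Finset.range n, ∑ j ∈ (Finset.range n).erase i, f (Z j ω, (Z i ω).2)

theorem IsIIDSample.integrable_mul (hZ : IsIIDSample μ P Z) {f : Obs p × ℝ → ℝ}
    (hf : MemLp f 2 (P.prod (P.map (Prod.snd : Obs p → ℝ)))) {i j l : ℕ} (hj : j ≠ i)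
    (hl : l ≠ i) :
    Integrable (fun ω => f (Z l ω, (Z i ω).2) * f (Z j ω, (Z i ω).2)) μ :=
  (hf.comp_measurePreserving (hZ.measurePreserving_prodMk_snd hl)).integrable_mul
    (hf.comp_measurePreserving (hZ.measurePreserving_prodMk_snd hj))

theorem IsIIDSample.integral_sq_sum_le [IsProbabilityMeasure P]
    (hZ : IsIIDSample μ P Z) {f : Obs p × ℝ → ℝ}
    (hf : MemLp f 2 (P.prod (P.map (Prod.snd : Obs p → ℝ)))) (hf0 : ∀ t, ∫ z, f (z, t) ∂P = 0)
    (n i : ℕ) :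
    ∫ ω, (∑ j ∈ (Finset.range n).erase i, f (Z j ω, (Z i ω).2)) ^ 2 ∂μ ≤
      n * ∫ w, f w ^ 2 ∂(P.prod (P.map (Prod.snd : Obs p → ℝ))) := by
  set σ := ∫ w, f w ^ 2 ∂(P.prod (P.map (Prod.snd : Obs p → ℝ))) with hσ
  have hσ0 : 0 ≤ σ := integral_nonneg fun _ => sq_nonneg _
  have hdiag : ∀ j, j ≠ i → ∫ ω, f (Z j ω, (Z i ω).2) * f (Z j ω, (Z i ω).2) ∂μ = σ := by
    intro j hj
    have hmp := hZ.measurePreserving_prodMk_snd hj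
    rw [hσ, ← hmp.map_eq, integral_map hmp.measurable.aemeasurable]
    · simp_rw [sq]
    · rw [hmp.map_eq]
      exact (hf.aestronglyMeasurable.pow 2)
  simp_rw [sq, Finset.sum_mul_sum]
  rw [integral_finsetSum]
  · calc ∑ j ∈ (Finset.range n).erase i, ∫ ω, ∑ l ∈ (Finset.range n).erase i,
            f (Z j ω, (Z i ω).2) * f (Z l ω, (Z i ω).2) ∂μ
        = ∑ j ∈ (Finset.range n).erase i, σ := by
          refine Finset.sum_congr rfl fun j hj => ?_
          have hji := Finset.ne_of_mem_erase hj
          rw [integral_finsetSum _ fun l hl =>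
            hZ.integrable_mul hf (Finset.ne_of_mem_erase hl) hji]
          rw [Finset.sum_eq_single_of_mem j hj, hdiag j hji]
          intro l hl hlj
          exact hZ.integral_mul_eq_zero hf hf0 (Finset.ne_of_mem_erase hl) hlj.symm hji
      _ ≤ n * σ := by
          rw [Finset.sum_const, nsmul_eq_mul]
          gcongr
          exact (Finset.card_erase_le).trans_eq (Finset.card_range n)
  · exact fun j hj => integrable_finsetSum _ fun l hl =>
      hZ.integrable_mul hf (Finset.ne_of_mem_erase hl) (Finset.ne_of_mem_erase hj)

theorem IsIIDSample.integrable_sq_sum (hZ : IsIIDSample μ P Z) {f : Obs p × ℝ → ℝ}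
    (hf : MemLp f 2 (P.prod (P.map (Prod.snd : Obs p → ℝ)))) (n i : ℕ) :
    MemLp (fun ω => ∑ j ∈ (Finset.range n).erase i, f (Z j ω, (Z i ω).2)) 2 μ :=
  memLp_finsetSum _ fun _ hj => hf.comp_measurePreserving
    (hZ.measurePreserving_prodMk_snd (Finset.ne_of_mem_erase hj))

theorem IsIIDSample.memLp_offDiagSum (hZ : IsIIDSample μ P Z) {f : Obs p × ℝ → ℝ}
    (hf : MemLp f 2 (P.prod (P.map (Prod.snd : Obs p → ℝ)))) (n : ℕ) :
    MemLp (offDiagSum Z f n) 2 μ :=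
  memLp_finsetSum _ fun i _ => hZ.integrable_sq_sum hf n i

/-- Cauchy–Schwarz over `i`, then orthogonality over `j` for each fixed `i`. After division by `n ^
2` the sum has size `n^{-1/2}`. -/
theorem IsIIDSample.integral_offDiagSum_sq_le [IsProbabilityMeasure P]
    (hZ : IsIIDSample μ P Z) {f : Obs p × ℝ → ℝ}
    (hf : MemLp f 2 (P.prod (P.map (Prod.snd : Obs p → ℝ)))) (hf0 : ∀ t, ∫ z, f (z, t) ∂P = 0)
    (n : ℕ) :
    ∫ ω, offDiagSum Z f n ω ^ 2 ∂μ ≤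
      n ^ 3 * ∫ w, f w ^ 2 ∂(P.prod (P.map (Prod.snd : Obs p → ℝ))) := by
  set σ := ∫ w, f w ^ 2 ∂(P.prod (P.map (Prod.snd : Obs p → ℝ))) with hσ
  have hi : ∀ i, Integrable
      (fun ω => (∑ j ∈ (Finset.range n).erase i, f (Z j ω, (Z i ω).2)) ^ 2) μ := fun i =>
    (hZ.integrable_sq_sum hf n i).integrable_sq
  calc ∫ ω, offDiagSum Z f n ω ^ 2 ∂μ
      ≤ ∫ ω, n * ∑ i ∈ Finset.range n,
          (∑ j ∈ (Finset.range n).erase i, f (Z j ω, (Z i ω).2)) ^ 2 ∂μ := by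
        refine integral_mono (hZ.memLp_offDiagSum hf n).integrable_sq
          ((integrable_finsetSum _ fun i _ => hi i).const_mul _) fun ω => ?_
        simpa [offDiagSum] using sq_sum_le_card_mul_sum_sq (s := Finset.range n)
          (f := fun i => ∑ j ∈ (Finset.range n).erase i, f (Z j ω, (Z i ω).2))
    _ = n * ∑ i ∈ Finset.range n,
          ∫ ω, (∑ j ∈ (Finset.range n).erase i, f (Z j ω, (Z i ω).2)) ^ 2 ∂μ := by
        rw [integral_const_mul, integral_finsetSum _ fun i _ => hi i]
    _ ≤ n * ∑ i ∈ Finset.range n, n * σ := by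
        gcongr with i
        exact hZ.integral_sq_sum_le hf hf0 n i
    _ = n ^ 3 * σ := by
        rw [Finset.sum_const, Finset.card_range, nsmul_eq_mul]
        ring

theorem eventually_log_div_pos : ∀ᶠ n : ℕ in atTop, 0 < Real.log n / n := by
  filter_upwards [eventually_ge_atTop 2] with n hn
  have h2 : (1 : ℝ) < n := by exact_mod_cast hn
  exact div_pos (Real.log_pos h2) (by linarith)

theorem tendsto_log_natCast_atTop : Tendsto (fun n : ℕ => Real.log n) atTop atTop :=
  Real.tendsto_log_atTop.comp tendsto_natCast_atTop_atTop

theorem tendsto_log_div_natCast : Tendsto (fun n : ℕ => Real.log n / n) atTop (𝓝 0) :=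
  Real.isLittleO_log_id_atTop.tendsto_div_nhds_zero.comp tendsto_natCast_atTop_atTop

/-- Chebyshev leaves `σ / (κ ^ 2 * log n)`: the logarithm in `c` is what makes it vanish. -/
theorem IsIIDSample.tendsto_offDiagSum [IsProbabilityMeasure P]
    (hZ : IsIIDSample μ P Z) {f : Obs p × ℝ → ℝ}
    (hf : MemLp f 2 (P.prod (P.map (Prod.snd : Obs p → ℝ)))) (hf0 : ∀ t, ∫ z, f (z, t) ∂P = 0)
    {κ : ℝ} (hκ : 0 < κ) :
    Tendsto (fun n : ℕ => μ {ω | κ * √(Real.log n / n) * n ^ 2 ≤ |offDiagSum Z f n ω|})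
      atTop (𝓝 0) := by
  set σ := ∫ w, f w ^ 2 ∂(P.prod (P.map (Prod.snd : Obs p → ℝ))) with hσ
  have hlim := tendsto_measure_ge_of_integral_le (μ := μ)
    (X := fun n ω => offDiagSum Z f n ω ^ 2) (a := fun n : ℕ => n ^ 3 * σ)
    (r := fun n : ℕ => (κ * √(Real.log n / n) * n ^ 2) ^ 2) (fun n ω => sq_nonneg _)
    (fun n => (hZ.memLp_offDiagSum hf n).integrable_sq)
    (fun n => hZ.integral_offDiagSum_sq_le hf hf0 n) ?_ ?_
  · refine tendsto_of_tendsto_of_tendsto_of_le_of_le tendsto_const_nhds hlim (fun _ => zero_le)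
      fun n => measure_mono fun ω hω => ?_
    have h : κ * √(Real.log n / n) * n ^ 2 ≤ |offDiagSum Z f n ω| := hω
    have := pow_le_pow_left₀ (by positivity) h 2
    rwa [sq_abs] at this
  · filter_upwards [eventually_log_div_pos, eventually_gt_atTop 0] with n h1 h2
    have h3 : (0 : ℝ) < n := by exact_mod_cast h2
    positivity
  · have h1 : Tendsto (fun n : ℕ => σ / (κ ^ 2 * Real.log n)) atTop (𝓝 0) :=
      tendsto_const_nhds.div_atTop (tendsto_log_natCast_atTop.const_mul_atTop (by positivity))
    refine h1.congr' ?_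
    filter_upwards [eventually_log_div_pos, eventually_gt_atTop 0] with n h1 h2
    have h3 : (0 : ℝ) < n := by exact_mod_cast h2
    have h4 : Real.log n ≠ 0 := fun h => by simp [h] at h1
    rw [mul_pow, mul_pow, Real.sq_sqrt h1.le]
    field_simp

/-- Markov with a first moment suffices: the sum has `n` terms against a threshold of order `n ^ 2 *
√c`. -/
theorem IsIIDSample.tendsto_diagSum (hZ : IsIIDSample μ P Z) {h : Obs p → ℝ}
    (hh : Integrable h P) {κ : ℝ} (hκ : 0 < κ) :
    Tendsto (fun n : ℕ => μ {ω | κ * √(Real.log n / n) * n ^ 2 ≤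
      |∑ i ∈ Finset.range n, h (Z i ω)|}) atTop (𝓝 0) := by
  have hi : ∀ i, Integrable (fun ω => |h (Z i ω)|) μ := fun i =>
    ((hZ.measurePreserving i).integrable_comp hh.aestronglyMeasurable |>.2 hh).abs
  have hlim := tendsto_measure_ge_of_integral_le (μ := μ)
    (X := fun n ω => ∑ i ∈ Finset.range n, |h (Z i ω)|) (a := fun n : ℕ => n * ∫ z, |h z| ∂P)
    (r := fun n : ℕ => κ * √(Real.log n / n) * n ^ 2)
    (fun n ω => Finset.sum_nonneg fun _ _ => abs_nonneg _)
    (fun n => integrable_finsetSum _ fun i _ => hi i) (fun n => ?_) ?_ ?_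
  · exact tendsto_of_tendsto_of_tendsto_of_le_of_le tendsto_const_nhds hlim (fun _ => zero_le)
      fun n => measure_mono fun ω hω => by
        rw [Set.mem_ofPred_eq] at hω ⊢
        exact hω.trans (Finset.abs_sum_le_sum_abs _ _)
  · rw [integral_finsetSum _ fun i _ => hi i]
    refine le_of_eq ?_
    rw [Finset.sum_congr rfl fun i _ => ?_, Finset.sum_const, Finset.card_range, nsmul_eq_mul]
    rw [← hZ.law i, integral_map (hZ.measurable i).aemeasurable]
    rw [hZ.law i]
    exact hh.abs.aestronglyMeasurable
  · filter_upwards [eventually_log_div_pos, eventually_gt_atTop 0] with n h1 h2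
    have h3 : (0 : ℝ) < n := by exact_mod_cast h2
    positivity
  · have h0 : Tendsto (fun n : ℕ => Real.log n * n) atTop atTop :=
      tendsto_log_natCast_atTop.atTop_mul_atTop₀ tendsto_natCast_atTop_atTop
    have h1 : Tendsto (fun n : ℕ => (∫ z, |h z| ∂P) / (κ * √(Real.log n * n))) atTop (𝓝 0) :=
      tendsto_const_nhds.div_atTop
        ((Real.tendsto_sqrt_atTop.comp h0).const_mul_atTop hκ)
    refine h1.congr' ?_
    filter_upwards [eventually_gt_atTop 0] with n h2
    have h3 : (0 : ℝ) < n := by exact_mod_cast h2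
    have h4 : √(Real.log n * n) = √(Real.log n / n) * n := by
      rw [show Real.log n * n = Real.log n / n * (n : ℝ) ^ 2 by field_simp,
        Real.sqrt_mul' _ (sq_nonneg _), Real.sqrt_sq h3.le]
    rw [h4]
    field_simp

theorem IsIIDSample.tendsto_average (hZ : IsIIDSample μ P Z) {h : Obs p → ℝ}
    (hh : Integrable h P) {η : ℝ} (hη : 0 < η) :
    Tendsto (fun n : ℕ => μ {ω | η ≤ |(n : ℝ)⁻¹ * ∑ i ∈ Finset.range n, h (Z i ω) -
      ∫ z, h z ∂P|}) atTop (𝓝 0) := by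
  have hi : ∀ i, Integrable (fun ω => h (Z i ω)) μ := fun i =>
    (hZ.measurePreserving i).integrable_comp hh.aestronglyMeasurable |>.2 hh
  have hae : ∀ i, AEMeasurable h (μ.map (Z i)) := fun i => by
    rw [hZ.law i]; exact hh.aemeasurable
  have hZid : ∀ i, IdentDistrib (Z i) (Z 0) μ μ := fun i =>
    ⟨(hZ.measurable i).aemeasurable, (hZ.measurable 0).aemeasurable, by rw [hZ.law, hZ.law]⟩
  have hint : ∫ ω, h (Z 0 ω) ∂μ = ∫ z, h z ∂P := by
    rw [← hZ.law 0, integral_map (hZ.measurable 0).aemeasurable]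
    rw [hZ.law 0]
    exact hh.aestronglyMeasurable
  have hslln := strong_law_ae_real (fun i ω => h (Z i ω)) (hi 0)
    (fun i j hij => (hZ.indep.indepFun hij).comp₀ (hZ.measurable i).aemeasurable
      (hZ.measurable j).aemeasurable (hae i) (hae j))
    (fun i => (hZid i).comp_of_aemeasurable (hae i))
  have hmeas := tendstoInMeasure_of_tendsto_ae
    (fun n => ((integrable_finsetSum _ fun i _ => hi i).div_const (n : ℝ)).aestronglyMeasurable)
    hslln
  have h1 := hmeas (ENNReal.ofReal η) (by simpa using hη)
  refine h1.congr fun n => congrArg μ (Set.ext fun ω => ?_)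
  simp only [Set.mem_ofPred_eq]
  rw [edist_dist, ENNReal.ofReal_le_ofReal_iff dist_nonneg, Real.dist_eq, hint, div_eq_inv_mul]

end VStatistic

/-! ### Distance from the DEE matrix to the average of the `M(Y_i)`. -/

theorem abs_apply_le_frobNorm {p : ℕ} (A : Matrix (Fin p) (Fin p) ℝ) (a b : Fin p) :
    |A a b| ≤ frobNorm A := by
  refine Real.abs_le_sqrt ?_
  calc A a b ^ 2 ≤ ∑ j, A a j ^ 2 :=
        Finset.single_le_sum (f := fun j => A a j ^ 2) (fun _ _ => sq_nonneg _) (Finset.mem_univ b)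
    _ ≤ ∑ i, ∑ j, A i j ^ 2 :=
        Finset.single_le_sum (f := fun i => ∑ j, A i j ^ 2)
          (fun _ _ => Finset.sum_nonneg fun _ _ => sq_nonneg _) (Finset.mem_univ a)

theorem entrySum_le_of_forall_abs_le {p : ℕ} {A : Matrix (Fin p) (Fin p) ℝ} {r : ℝ}
    (h : ∀ a b, |A a b| ≤ r) : entrySum A ≤ p ^ 2 * r := by
  calc entrySum A ≤ ∑ _a : Fin p, ∑ _b : Fin p, r :=
        Finset.sum_le_sum fun a _ => Finset.sum_le_sum fun b _ => h a b
    _ = p ^ 2 * r := by simp; ring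

/-- The average `n⁻¹ ∑ᵢ M(yᵢ)` of the population matrices over the sample. -/
def averageMatrix {p : ℕ} (M : ℝ → Matrix (Fin p) (Fin p) ℝ) (n : ℕ) (s : Fin n → Obs p) :
    Matrix (Fin p) (Fin p) ℝ :=
  (n : ℝ)⁻¹ • ∑ i, M (s i).2

/-- The expectation `E M(Y)`. -/
def meanMatrix {p : ℕ} (P : Measure (Obs p)) (M : ℝ → Matrix (Fin p) (Fin p) ℝ) :
    Matrix (Fin p) (Fin p) ℝ :=
  Matrix.of fun a b => ∫ z, M z.2 a b ∂P

section Sample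

variable {p : ℕ} {Ω : Type*} {Z : ℕ → Ω → Obs p} {M : ℝ → Matrix (Fin p) (Fin p) ℝ}
  {ψ : Obs p → ℝ → Matrix (Fin p) (Fin p) ℝ} {Mn : KernelEstimator p}

theorem averageMatrix_apply (n : ℕ) (ω : Ω) (a b : Fin p) :
    averageMatrix M n (sampleOf Z n ω) a b =
      (n : ℝ)⁻¹ * ∑ i ∈ Finset.range n, M (Z i ω).2 a b := by
  simp [averageMatrix, sampleOf, Matrix.sum_apply,
    Finset.sum_range fun i => M (Z i ω).2 a b]

theorem sum_sum_eq_offDiagSum_add (Z : ℕ → Ω → Obs p) (f : Obs p × ℝ → ℝ) (n : ℕ) (ω : Ω) :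
    ∑ i ∈ Finset.range n, ∑ j ∈ Finset.range n, f (Z j ω, (Z i ω).2) =
      offDiagSum Z f n ω + ∑ i ∈ Finset.range n, f (Z i ω, (Z i ω).2) := by
  rw [offDiagSum, ← Finset.sum_add_distrib]
  exact Finset.sum_congr rfl fun i hi => (Finset.sum_erase_add _ _ hi).symm

/-- The terms `i = j` are split off because `ψ(X, Y, Y)` is not assumed centred or square
integrable. -/
theorem deeMatrix_sub_averageMatrix_apply (n : ℕ) (ω : Ω) (a b : Fin p) :
    (deeMatrix Mn n (sampleOf Z n ω) - averageMatrix M n (sampleOf Z n ω)) a b =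
      (n : ℝ)⁻¹ * (n : ℝ)⁻¹ * offDiagSum Z (fun w => ψ w.1 w.2 a b) n ω +
      (n : ℝ)⁻¹ * (n : ℝ)⁻¹ * ∑ i ∈ Finset.range n, ψ (Z i ω) (Z i ω).2 a b +
      (n : ℝ)⁻¹ * ∑ i ∈ Finset.range n,
        linRemainder M ψ Mn n (sampleOf Z n ω) (Z i ω).2 a b := by
  have hexp : ∀ t, Mn n (sampleOf Z n ω) t a b - M t a b =
      (n : ℝ)⁻¹ * ∑ j ∈ Finset.range n, ψ (Z j ω) t a b +
      linRemainder M ψ Mn n (sampleOf Z n ω) t a b := fun t => by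
    simp [linRemainder, sampleOf, Matrix.sum_apply, Finset.sum_range fun j => ψ (Z j ω) t a b]
  have h1 : (deeMatrix Mn n (sampleOf Z n ω) - averageMatrix M n (sampleOf Z n ω)) a b =
      (n : ℝ)⁻¹ * ∑ i ∈ Finset.range n,
        (Mn n (sampleOf Z n ω) (Z i ω).2 a b - M (Z i ω).2 a b) := by
    rw [Matrix.sub_apply, averageMatrix_apply, Finset.sum_sub_distrib, mul_sub]
    simp [deeMatrix, Matrix.sum_apply, Finset.sum_range, sampleOf]
  rw [h1, Finset.sum_congr rfl fun i _ => hexp _, Finset.sum_add_distrib, ← Finset.mul_sum,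
    sum_sum_eq_offDiagSum_add Z (fun w => ψ w.1 w.2 a b)]
  ring

theorem abs_deeMatrix_sub_averageMatrix_le {n : ℕ} (hn : 0 < n) {ω : Ω} {a b : Fin p} {κ : ℝ}
    (hκ : 1 ≤ κ * √(Real.log n))
    (hoff : |offDiagSum Z (fun w => ψ w.1 w.2 a b) n ω| ≤ κ * √(Real.log n / n) * n ^ 2)
    (hdiag : |∑ i ∈ Finset.range n, ψ (Z i ω) (Z i ω).2 a b| ≤ κ * √(Real.log n / n) * n ^ 2)
    (hrem : ∀ t, √(n : ℝ) * frobNorm (linRemainder M ψ Mn n (sampleOf Z n ω) t) ≤ 1) :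
    |(deeMatrix Mn n (sampleOf Z n ω) - averageMatrix M n (sampleOf Z n ω)) a b| ≤
      3 * (κ * √(Real.log n / n)) := by
  have hn' : (0 : ℝ) < n := by exact_mod_cast hn
  have hs : 0 < √(n : ℝ) := Real.sqrt_pos.2 hn'
  have hinv : (n : ℝ)⁻¹ * (n : ℝ)⁻¹ * (κ * √(Real.log n / n) * n ^ 2) =
      κ * √(Real.log n / n) := by field_simp
  have hR : ∀ t, |linRemainder M ψ Mn n (sampleOf Z n ω) t a b| ≤ κ * √(Real.log n / n) := by
    intro t
    refine (abs_apply_le_frobNorm _ a b).trans ?_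
    -- The remainder is at most `1 / √n`, and `hκ` says that this is at most `κ * √c`.
    rw [Real.sqrt_div' _ hn'.le, ← mul_div_assoc, le_div_iff₀ hs, mul_comm]
    exact (hrem t).trans hκ
  have hRs : |(n : ℝ)⁻¹ * ∑ i ∈ Finset.range n,
      linRemainder M ψ Mn n (sampleOf Z n ω) (Z i ω).2 a b| ≤ κ * √(Real.log n / n) := by
    rw [abs_mul, abs_of_pos (inv_pos.2 hn'), inv_mul_le_iff₀ hn']
    refine (Finset.abs_sum_le_sum_abs _ _).trans ?_
    refine (Finset.sum_le_sum fun i _ => hR (Z i ω).2).trans ?_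
    simp
  have h1 : |(n : ℝ)⁻¹ * (n : ℝ)⁻¹ * offDiagSum Z (fun w => ψ w.1 w.2 a b) n ω| ≤
      κ * √(Real.log n / n) := by
    rw [abs_mul, abs_of_pos (by positivity : (0 : ℝ) < (n : ℝ)⁻¹ * (n : ℝ)⁻¹), ← hinv]
    gcongr
  have h2 : |(n : ℝ)⁻¹ * (n : ℝ)⁻¹ * ∑ i ∈ Finset.range n, ψ (Z i ω) (Z i ω).2 a b| ≤
      κ * √(Real.log n / n) := by
    rw [abs_mul, abs_of_pos (by positivity : (0 : ℝ) < (n : ℝ)⁻¹ * (n : ℝ)⁻¹), ← hinv]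
    gcongr
  rw [deeMatrix_sub_averageMatrix_apply (ψ := ψ)]
  refine (abs_add_three _ _ _).trans ?_
  linarith

end Sample

/-! ### The population matrices on `C` and on `Cᗮ`. -/

section Population

variable {p : ℕ} {P : Measure (Obs p)} {M : ℝ → Matrix (Fin p) (Fin p) ℝ}

theorem quadForm_nonneg_of_posSemidef {A : Matrix (Fin p) (Fin p) ℝ} (hA : A.PosSemidef)
    (x : Covar p) : 0 ≤ quadForm A x := by
  rw [quadForm_eq_dotProduct]
  simpa using hA.dotProduct_mulVec_nonneg x.ofLp

theorem quadForm_eq_zero_of_mem_orthogonal {A : Matrix (Fin p) (Fin p) ℝ} {x : Covar p}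
    (hx : x ∈ (matrixSpan A)ᗮ) : quadForm A x = 0 := by
  have h : ∀ j, ∑ i, x i * A i j = 0 := fun j => by
    have := (Submodule.mem_orthogonal _ _).1 hx (WithLp.toLp 2 (A.col j))
      (Submodule.subset_span ⟨j, rfl⟩)
    simpa [EuclideanSpace.inner_eq_star_dotProduct, dotProduct, Matrix.col] using this
  rw [quadForm, Finset.sum_comm]
  refine Finset.sum_eq_zero fun j _ => ?_
  rw [← Finset.sum_mul, h j, zero_mul]

theorem matrixSpan_le_orthogonal_of_quadForm_eq_zero {A : Matrix (Fin p) (Fin p) ℝ}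
    (hA : A.PosSemidef) {x : Covar p} (hx : quadForm A x = 0) :
    matrixSpan A ≤ (Submodule.span ℝ {x})ᗮ := by
  rw [quadForm_eq_dotProduct] at hx
  have h := (hA.dotProduct_mulVec_zero_iff x.ofLp).1 (by simpa using hx)
  rw [matrixSpan, Submodule.span_le]
  rintro _ ⟨j, rfl⟩
  rw [SetLike.mem_coe, Submodule.mem_orthogonal_singleton_iff_inner_right]
  have hj := congrFun h j
  have hsymm : ∀ i, A i j = A j i := fun i => by
    simpa using hA.isHermitian.apply j i
  simp only [Matrix.mulVec, dotProduct, Pi.zero_apply] at hj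
  simp only [EuclideanSpace.inner_eq_star_dotProduct, dotProduct, Matrix.col, star_trivial,
    Matrix.transpose_apply]
  simp_rw [hsymm]
  exact hj

theorem quadForm_meanMatrix (hM : ∀ i j, Integrable (fun z : Obs p => M z.2 i j) P)
    (x : Covar p) : quadForm (meanMatrix P M) x = ∫ z, quadForm (M z.2) x ∂P := by
  have hi : ∀ i j, Integrable (fun z : Obs p => x i * M z.2 i j * x j) P := fun i j =>
    ((hM i j).const_mul _).mul_const _
  simp only [quadForm]
  rw [integral_finsetSum _ fun i _ => integrable_finsetSum _ fun j _ => hi i j]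
  refine Finset.sum_congr rfl fun i _ => ?_
  rw [integral_finsetSum _ fun j _ => hi i j]
  refine Finset.sum_congr rfl fun j _ => ?_
  rw [integral_mul_const, integral_const_mul]
  rfl

theorem integrable_quadForm (hM : ∀ i j, Integrable (fun z : Obs p => M z.2 i j) P)
    (x : Covar p) : Integrable (fun z : Obs p => quadForm (M z.2) x) P :=
  integrable_finsetSum _ fun i _ => integrable_finsetSum _ fun j _ =>
    ((hM i j).const_mul _).mul_const _

variable [IsProbabilityMeasure P]

theorem IsDEEKernel.quadForm_eq_zero (hM : IsDEEKernel P M) (t : ℝ) {x : Covar p}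
    (hx : x ∈ (centralSubspace P (Prod.snd : Obs p → ℝ))ᗮ) : quadForm (M t) x = 0 := by
  refine quadForm_eq_zero_of_mem_orthogonal ?_
  rw [hM.span_eq t]
  exact Submodule.orthogonal_le (centralSubspace_discretized_le t) hx

/-- A nonnegative form with zero mean vanishes a.s., so the complement of `x` contains the central
subspace of `Z(t) | X` for almost every value `t` of `Y`; it then contains that of `Y | X`, and `x`
is orthogonal to itself. -/
theorem IsDEEKernel.quadForm_meanMatrix_pos (hM : IsDEEKernel P M)
    (hexist : ∀ t, IsDimReduction P (discretized t) (centralSubspace P (discretized t)))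
    {x : Covar p} (hx : x ∈ centralSubspace P (Prod.snd : Obs p → ℝ)) (hx0 : x ≠ 0) :
    0 < quadForm (meanMatrix P M) x := by
  have hnn : ∀ z : Obs p, 0 ≤ quadForm (M z.2) x := fun z =>
    quadForm_nonneg_of_posSemidef (hM.posSemidef z.2) x
  rw [quadForm_meanMatrix hM.integrable]
  refine lt_of_le_of_ne (integral_nonneg hnn) fun h0 => hx0 ?_
  have h1 := (integral_eq_zero_iff_of_nonneg hnn (integrable_quadForm hM.integrable x)).1 h0.symm
  have h2 : ∀ᵐ z ∂P, centralSubspace P (discretized z.2) ≤ (Submodule.span ℝ {x})ᗮ := by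
    filter_upwards [h1] with z hz
    rw [← hM.span_eq]
    exact matrixSpan_le_orthogonal_of_quadForm_eq_zero (hM.posSemidef z.2) hz
  have h3 : x ∈ (Submodule.span ℝ {x})ᗮ :=
    (sInf_le (isDimReduction_snd_of_ae_le hexist h2) :
      centralSubspace P (Prod.snd : Obs p → ℝ) ≤ _) hx
  rw [Submodule.mem_orthogonal_singleton_iff_inner_right] at h3
  exact inner_self_eq_zero.1 h3

/-- Compactness of the unit sphere of `C`. -/
theorem exists_pos_forall_mul_le_quadForm {A : Matrix (Fin p) (Fin p) ℝ}
    {C : Submodule ℝ (Covar p)} (h : ∀ x ∈ C, x ≠ 0 → 0 < quadForm A x) :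
    ∃ δ > 0, ∀ x ∈ C, 3 * δ * ‖x‖ ^ 2 ≤ quadForm A x := by
  have hcont : Continuous (quadForm A) := by
    unfold quadForm
    fun_prop
  have hcpt : IsCompact (Metric.sphere (0 : Covar p) 1 ∩ C) :=
    (isCompact_sphere _ _).inter_right C.closed_of_finiteDimensional
  obtain ⟨m, hm, hmle⟩ : ∃ m > 0, ∀ x ∈ Metric.sphere (0 : Covar p) 1 ∩ C, m ≤ quadForm A x := by
    rcases (Metric.sphere (0 : Covar p) 1 ∩ C).eq_empty_or_nonempty with he | hne
    · exact ⟨1, one_pos, by simp [he]⟩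
    · obtain ⟨y, hy, hmin⟩ := hcpt.exists_isMinOn hne hcont.continuousOn
      refine ⟨quadForm A y, h y hy.2 ?_, fun x hx => hmin hx⟩
      rintro rfl
      simpa using hy.1
  refine ⟨m / 3, by positivity, fun x hx => ?_⟩
  by_cases hx0 : x = 0
  · subst hx0
    simp [quadForm]
  · have hxn : 0 < ‖x‖ := norm_pos_iff.2 hx0
    have h1 := hmle (‖x‖⁻¹ • x) ⟨by simp [norm_smul, hxn.ne'], C.smul_mem _ hx⟩
    have h2 : quadForm A (‖x‖⁻¹ • x) = (‖x‖ ^ 2)⁻¹ * quadForm A x := by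
      simp only [quadForm, Finset.mul_sum, PiLp.smul_apply, smul_eq_mul]
      refine Finset.sum_congr rfl fun i _ => Finset.sum_congr rfl fun j _ => ?_
      rw [← inv_pow]; ring
    rw [h2, inv_mul_eq_div, le_div_iff₀ (by positivity)] at h1
    linarith

theorem quadForm_averageMatrix (n : ℕ) (s : Fin n → Obs p) (x : Covar p) :
    quadForm (averageMatrix M n s) x = (n : ℝ)⁻¹ * ∑ i, quadForm (M (s i).2) x := by
  rw [averageMatrix, quadForm_smul, quadForm_sum]

theorem isSymm_deeMatrix {Mn : KernelEstimator p} (h : ∀ n s t, (Mn n s t).IsSymm) (n : ℕ)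
    (s : Fin n → Obs p) : (deeMatrix Mn n s).IsSymm := by
  rw [Matrix.IsSymm, deeMatrix, Matrix.transpose_smul, Matrix.transpose_sum]
  congr 1
  exact Finset.sum_congr rfl fun i _ => h n s _

end Population

/-! ### Consistency, and the dimension under each hypothesis. -/

section Consistency

variable {p : ℕ} {P : Measure (Obs p)} [IsProbabilityMeasure P]

/-- The ridge-type eigenvalue ratio estimator is consistent for the dimension of the central
subspace. -/
theorem tendsto_measure_eq_finrank_centralSubspace
    (hexist : ∀ t, IsDimReduction P (discretized t) (centralSubspace P (discretized t)))
    {Ω : Type*} [MeasurableSpace Ω] {μ : Measure Ω} [IsProbabilityMeasure μ]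
    {Z : ℕ → Ω → Obs p} (hZ : IsIIDSample μ P Z)
    {M : ℝ → Matrix (Fin p) (Fin p) ℝ} (hM : IsDEEKernel P M)
    {ψ : Obs p → ℝ → Matrix (Fin p) (Fin p) ℝ} {Mn : KernelEstimator p}
    (hMn : HasLinearExpansion μ P Z M ψ Mn)
    {qhat : (n : ℕ) → (Fin n → Obs p) → ℕ}
    (hq : ∀ n s, IsMRER (deeMatrix Mn n s) (Real.log n / n) (qhat n s))
    (hC : 1 ≤ Module.finrank ℝ (centralSubspace P (Prod.snd : Obs p → ℝ))) :
    Tendsto (fun n : ℕ => μ {ω | qhat n (sampleOf Z n ω) =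
      Module.finrank ℝ (centralSubspace P (Prod.snd : Obs p → ℝ))}) atTop (𝓝 1) := by
  set C := centralSubspace P (Prod.snd : Obs p → ℝ) with hCdef
  obtain ⟨δ, hδ, hδC⟩ := exists_pos_forall_mul_le_quadForm
    (fun x hx hx0 => hM.quadForm_meanMatrix_pos hexist hx hx0)
  have hp : 0 < p := by
    have := C.finrank_le
    rw [finrank_euclideanSpace, Fintype.card_fin] at this
    omega
  have hp' : (0 : ℝ) < p := by exact_mod_cast hp
  -- Each of the `p ^ 2` entries of `M_n - A₀` is a sum of three pieces of size `κ * √c`, for a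
  -- total of `√c`; likewise `η` below makes the total for `A₀ - E M(Y)` equal to `δ`.
  set κ : ℝ := (3 * (p : ℝ) ^ 2)⁻¹ with hκdef
  have hκ : 0 < κ := by positivity
  set η : ℝ := δ / (p : ℝ) ^ 2 with hηdef
  have hη : 0 < η := by positivity
  let off : Fin p × Fin p → ℕ → Set Ω := fun e n => {ω | κ * √(Real.log n / n) * n ^ 2 ≤
    |offDiagSum Z (fun w => ψ w.1 w.2 e.1 e.2) n ω|}
  let diag : Fin p × Fin p → ℕ → Set Ω := fun e n => {ω | κ * √(Real.log n / n) * n ^ 2 ≤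
    |∑ i ∈ Finset.range n, ψ (Z i ω) (Z i ω).2 e.1 e.2|}
  let avg : Fin p × Fin p → ℕ → Set Ω := fun e n => {ω | η ≤
    |(n : ℝ)⁻¹ * ∑ i ∈ Finset.range n, M (Z i ω).2 e.1 e.2 - ∫ z, M z.2 e.1 e.2 ∂P|}
  let rem : ℕ → Set Ω := fun n =>
    {ω | ∃ t, 1 < √(n : ℝ) * frobNorm (linRemainder M ψ Mn n (sampleOf Z n ω) t)}
  have hbad : Tendsto (fun n => μ ((⋃ e, off e n) ∪ ((⋃ e, diag e n) ∪
      ((⋃ e, avg e n) ∪ rem n)))) atTop (𝓝 0) := by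
    refine tendsto_measure_union (tendsto_measure_iUnion_fintype fun e => ?_)
      (tendsto_measure_union (tendsto_measure_iUnion_fintype fun e => ?_)
      (tendsto_measure_union (tendsto_measure_iUnion_fintype fun e => ?_) ?_))
    · exact hZ.tendsto_offDiagSum (hMn.sq_integrable e.1 e.2)
        (fun t => (hMn.centred t e.1 e.2).2) hκ
    · exact hZ.tendsto_diagSum (hMn.diag_integrable e.1 e.2) hκ
    · exact hZ.tendsto_average (hM.integrable e.1 e.2) hη
    · exact hMn.remainder 1 one_pos
  have hc0 := tendsto_log_div_natCast
  have e1 : ∀ᶠ n : ℕ in atTop, √(Real.log n / n) < δ := by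
    have h := (Real.continuous_sqrt.tendsto 0).comp hc0
    rw [Real.sqrt_zero] at h
    exact h.eventually (gt_mem_nhds hδ)
  have e2 : ∀ᶠ n : ℕ in atTop, 4 * (Real.log n / n) < δ ^ 2 := by
    have : Tendsto (fun n : ℕ => 4 * (Real.log n / n)) atTop (𝓝 0) := by
      simpa using hc0.const_mul 4
    exact this.eventually (gt_mem_nhds (by positivity))
  have e3 : ∀ᶠ n : ℕ in atTop, 2 * (Real.log n / n) *
      ((entrySum (meanMatrix P M) + 2 * δ) ^ 2 + Real.log n / n) < δ ^ 2 * δ ^ 2 := by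
    have : Tendsto (fun n : ℕ => 2 * (Real.log n / n) *
        ((entrySum (meanMatrix P M) + 2 * δ) ^ 2 + Real.log n / n)) atTop (𝓝 0) := by
      simpa using (hc0.const_mul 2).mul
        (hc0.const_add ((entrySum (meanMatrix P M) + 2 * δ) ^ 2))
    exact this.eventually (gt_mem_nhds (by positivity))
  have e4 : ∀ᶠ n : ℕ in atTop, 1 ≤ κ * √(Real.log n) :=
    ((Real.tendsto_sqrt_atTop.comp tendsto_log_natCast_atTop).const_mul_atTop hκ).eventually
      (eventually_ge_atTop 1)
  -- For large `n`, the estimator can miss `dim C` only on the union of the bad events; off it the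
  -- perturbation bound is deterministic.
  refine tendsto_measure_one_of_compl (tendsto_of_tendsto_of_tendsto_of_le_of_le'
    tendsto_const_nhds hbad (Eventually.of_forall fun _ => zero_le) ?_)
  filter_upwards [e1, e2, e3, e4, eventually_log_div_pos, eventually_gt_atTop 0]
    with n h1 h2 h3 h4 hcpos hn
  refine measure_mono fun ω hω => ?_
  by_contra hgood
  refine hω ?_
  simp only [Set.mem_union, Set.mem_iUnion, not_or, not_exists] at hgood
  obtain ⟨g1, g2, g3, g4⟩ := hgood
  have k1 : ∀ a b, |offDiagSum Z (fun w => ψ w.1 w.2 a b) n ω| ≤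
      κ * √(Real.log n / n) * n ^ 2 := fun a b => (not_le.1 (g1 (a, b))).le
  have k2 : ∀ a b, |∑ i ∈ Finset.range n, ψ (Z i ω) (Z i ω).2 a b| ≤
      κ * √(Real.log n / n) * n ^ 2 := fun a b => (not_le.1 (g2 (a, b))).le
  have k3 : ∀ a b, |(n : ℝ)⁻¹ * ∑ i ∈ Finset.range n, M (Z i ω).2 a b -
      ∫ z, M z.2 a b ∂P| ≤ η := fun a b => (not_le.1 (g3 (a, b))).le
  have k4 : ∀ t, √(n : ℝ) * frobNorm (linRemainder M ψ Mn n (sampleOf Z n ω) t) ≤ 1 :=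
    fun t => not_lt.1 fun h => g4 ⟨t, h⟩
  refine IsMRER.eq_finrank (A₀ := averageMatrix M n (sampleOf Z n ω)) (A₁ := meanMatrix P M)
    (isSymm_deeMatrix hMn.symm n _) hC hδ hcpos h1.le h2 h3 (fun x => ?_) (fun x hx => ?_)
    hδC ?_ ?_ (hq n _)
  · rw [quadForm_averageMatrix]
    exact mul_nonneg (by positivity) (Finset.sum_nonneg fun i _ =>
      quadForm_nonneg_of_posSemidef (hM.posSemidef _) x)
  · rw [quadForm_averageMatrix, Finset.sum_eq_zero fun i _ => hM.quadForm_eq_zero _ hx, mul_zero]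
  · refine (entrySum_le_of_forall_abs_le fun a b => abs_deeMatrix_sub_averageMatrix_le hn h4
      (k1 a b) (k2 a b) k4).trans (le_of_eq ?_)
    rw [hκdef]
    field_simp
  · refine (entrySum_le_of_forall_abs_le (r := η) fun a b => ?_).trans (le_of_eq ?_)
    · rw [Matrix.sub_apply, averageMatrix_apply]
      exact k3 a b
    · rw [hηdef]
      field_simp

/-- If the central mean subspace is the central subspace, it is a mean dimension reduction
subspace, and so the smallest one. -/
theorem isMeanDimReduction_centralMeanSubspace
    (hexist : ∀ t, IsDimReduction P (discretized t) (centralSubspace P (discretized t)))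
    (hcentral : centralMeanSubspace P = centralSubspace P (Prod.snd : Obs p → ℝ)) :
    IsMeanDimReduction P (centralMeanSubspace P) := by
  rw [hcentral]
  exact (isDimReduction_snd_of_ae_le hexist
    (ae_of_all _ fun z => centralSubspace_discretized_le z.2)).isMeanDimReduction

theorem IsMultiIndex.finrank_centralMeanSubspace_le {r : ℕ} {B : Matrix (Fin p) (Fin r) ℝ}
    (h : IsMultiIndex P B) : Module.finrank ℝ (centralMeanSubspace P) ≤ r := by
  obtain ⟨S, hS, hmean⟩ := h.exists_isMeanDimReduction
  exact (Submodule.finrank_mono (sInf_le hmean : centralMeanSubspace P ≤ S)).trans hS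

theorem NullHyp.finrank_centralMeanSubspace {d : ℕ} {g : ℝ → EuclideanSpace ℝ (Fin d) → ℝ}
    {Θ : Set (EuclideanSpace ℝ (Fin d))} (h : NullHyp P g Θ)
    (hY : Integrable (Prod.snd : Obs p → ℝ) P) (hg : ∀ θ ∈ Θ, Measurable fun u => g u θ)
    (hmean : IsMeanDimReduction P (centralMeanSubspace P)) :
    Module.finrank ℝ (centralMeanSubspace P) = 1 := by
  obtain ⟨⟨β₀, θ₀, hθ₀, heq⟩, hconst⟩ := h
  refine le_antisymm ?_ (Nat.one_le_iff_ne_zero.2 fun h0 => ?_)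
  · refine IsMultiIndex.finrank_centralMeanSubspace_le
      (B := Matrix.of fun i (_ : Fin 1) => β₀ i) ⟨fun y => g (y 0) θ₀, ?_, ?_⟩
    · exact (hg θ₀ hθ₀).comp (Continuous.measurable (by fun_prop))
    · filter_upwards [heq] with z hz
      rw [hz, transposeApply_apply]
      rfl
  -- In dimension zero, `Bᵀ x` has no coordinates, so `E(Y|X)` would be a.s. constant.
  · obtain ⟨B, G, -, hG⟩ := hmean.exists_isMultiIndex hY
    refine hconst (G 0) (hG.trans (ae_of_all _ fun z => ?_))
    have : IsEmpty (Fin (Module.finrank ℝ (centralMeanSubspace P))) := by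
      rw [h0]; infer_instance
    exact congrArg G (Subsingleton.elim _ _)

theorem AltHyp.finrank_centralMeanSubspace {d q : ℕ} {g : ℝ → EuclideanSpace ℝ (Fin d) → ℝ}
    {Θ : Set (EuclideanSpace ℝ (Fin d))} (h : AltHyp P g Θ q)
    (hY : Integrable (Prod.snd : Obs p → ℝ) P)
    (hmean : IsMeanDimReduction P (centralMeanSubspace P)) :
    Module.finrank ℝ (centralMeanSubspace P) = q := by
  obtain ⟨-, ⟨B, -, hB⟩, hmin, -⟩ := h
  obtain ⟨B', hB'⟩ := hmean.exists_isMultiIndex hY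
  exact le_antisymm hB.finrank_centralMeanSubspace_le (hmin _ B' hB')

end Consistency

end

theorem lemma1 {p d : ℕ}
    -- the population, and the known regression function and parameter set of the null model
    (P : Measure (Obs p)) [IsProbabilityMeasure P]
    (hY : Integrable (Prod.snd : Obs p → ℝ) P)
    (g : ℝ → EuclideanSpace ℝ (Fin d) → ℝ) (Θ : Set (EuclideanSpace ℝ (Fin d)))
    (hg : ∀ θ ∈ Θ, Measurable fun u => g u θ)
    -- the central subspaces of the discretized responses exist, and `𝓢_{E(Y|X)} = 𝓢_{Y|X}`
    (hexist : ∀ t, IsDimReduction P (discretized t) (centralSubspace P (discretized t)))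
    (hcentral : centralMeanSubspace P = centralSubspace P (Prod.snd : Obs p → ℝ))
    -- the i.i.d. sample
    {Ω : Type*} [MeasurableSpace Ω] (μ : Measure Ω) [IsProbabilityMeasure μ]
    (Z : ℕ → Ω → Obs p) (hZ : IsIIDSample μ P Z)
    -- the chosen sufficient dimension reduction method and its regularity conditions
    (M : ℝ → Matrix (Fin p) (Fin p) ℝ) (hM : IsDEEKernel P M)
    (ψ : Obs p → ℝ → Matrix (Fin p) (Fin p) ℝ) (Mn : KernelEstimator p)
    (hMn : HasLinearExpansion μ P Z M ψ Mn)
    -- the estimator `q̂`, any selection of minimizers, with `c = log n / n`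
    (qhat : (n : ℕ) → (Fin n → Obs p) → ℕ)
    (hq : ∀ n s, IsMRER (deeMatrix Mn n s) (Real.log n / n) (qhat n s)) :
    (NullHyp P g Θ →
      Tendsto (fun n : ℕ => μ {ω | qhat n (sampleOf Z n ω) = 1}) atTop (𝓝 1)) ∧
    (∀ q : ℕ, AltHyp P g Θ q →
      Tendsto (fun n : ℕ => μ {ω | qhat n (sampleOf Z n ω) = q}) atTop (𝓝 1)) := by
  have hmean := isMeanDimReduction_centralMeanSubspace hexist hcentral
  have hcons := tendsto_measure_eq_finrank_centralSubspace hexist hZ hM hMn hq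
  rw [← hcentral] at hcons
  refine ⟨fun h0 => ?_, fun q h1 => ?_⟩
  · have hdim := h0.finrank_centralMeanSubspace hY hg hmean
    rw [hdim] at hcons
    exact hcons le_rfl
  · have hdim := h1.finrank_centralMeanSubspace hY hmean
    rw [hdim] at hcons
    exact hcons h1.1
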